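/- For $p,q\in\mathbb R$ let $\mathcal G_{p,q}$ be the weighted Gini mean on $(0,\infty)$: for $x\in(0,\infty)^n$ and weights $\lambda\in[0,\infty)^n$, not all zero, $$\mathcal G_{p,q}(x,\lambda)=\Big(\frac{\sum_i\lambda_ix_i^p}{\sum_i\lambda_ix_i^q}\Big)^{\frac1{p-q}}\ (p\neq q),\qquad \mathcal G_{p,p}(x,\lambda)=\exp\Big(\frac{\sum_i\lambda_ix_i^p\ln x_i}{\sum_i\lambda_ix_i^p}\Big).$$ For a bounded interval $J$ of positive length and an integrable $f\colon J\to(0,\infty)$ put $$\mathcal G^0_{p,q}(f)=\Big(\frac{\int_Jf^p}{\int_Jf^q}\Big)^{\frac1{p-q}}\ (p\neq q),\qquad \mathcal G^0_{p,p}(f)=\exp\Big(\frac{\int_Jf^p\ln f}{\int_Jf^p}\Big),$$ whenever $f^p,f^q$ (resp. $f^p,\ f^p\ln f$) are integrable on $J$; let $X_{p,q}$ be the set of these $f$. For a weighted mean $\mathcal M$ on $(0,\infty)$ and a simple function $g$ (equal to $v_i$ on consecutive intervals $D_i$ of positive length that partition its domain) put $\mathcal M(g)=\mathcal M((v_i),(|D_i|))$.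 Write $\overline{\mathrm{Rg}}(f)$ for the smallest closed interval containing the range of $f$. For an integrable $f\colon J\to (0,\infty)$ let $\tilde f$ be the function obtained by transporting $f$ to an interval with endpoints $0,1$ by the increasing affine map, and let $B_\varepsilon(\tilde f)$ be the set of positive simple functions $g$ on the domain of $\tilde f$ with $|\overline{\mathrm{Rg}}(g)\setminus\overline{\mathrm{Rg}}(\tilde f)|<\varepsilon$ and $\|\tilde f-g\|_1<\varepsilon$. The lower and upper means are $$\mathcal M^L(f)=\lim_{\varepsilon\to0}\inf_{g\in B_\varepsilon(\tilde f)}\mathcal M(g),\qquad \mathcal M^U(f)=\lim_{\varepsilon\to0}\sup_{g\in B_\varepsilon(\tilde f)}\mathcal M(g).$$ The Hardy constant $\mathrm{Hc}(\mathcal M)$ is the smallest $C\in[0,+\infty]$ with $\sum_{n\ge1}\lambda_n\mathcal M((x_1,\dots,x_n),(\lambda_1,\dots,\lambda_n))\le C\sum_{n\ge1}\lambda_nx_n$ for all sequences $x_n,\lambda_n>0$. The integral Hardy constant $\mathrm{iHc}(\mathcal G^0_{p,q})$ is the smallest $C\in[0,+\infty]$ with $\int_0^\infty\mathcal G^0_{p,q}(f|_{[0,t)})\,dt\le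 C\int_0^\infty f(t)\,dt$ for all integrable $f\colon[0,\infty)\to(0,\infty)$ with $f|_{[0,t)}\in X_{p,q}$ for all $t>0$. Then the following hold. 1. For all $p,q\in\mathbb R$, $\mathcal G^0_{p,q}$ is an integral mean on $X_{p,q}$: $\mathcal G^0_{p,q}(f)\in(0,\infty)\cap\overline{\mathrm{Rg}}(f)$, and if $g\colon J\to(0,\infty)$ is integrable and equal to $f\in X_{p,q}$ almost everywhere, then $g\in X_{p,q}$ and $\mathcal G^0_{p,q}(g)=\mathcal G^0_{p,q}(f)$. Every positive simple function $g$ on a bounded interval of positive length belongs to $X_{p,q}$, and $\mathcal G^0_{p,q}(g)=\mathcal G_{p,q}(g)$. 2. For all $p,q\in\mathbb R$, $\mathcal G^0_{p,q}$ is the unique function $N$ on $X_{p,q}$ such that $\mathcal G_{p,q}^L(f)=\mathcal G_{p,q}^U(f)=N(f)$ for all integrable $f$ on a bounded interval of positive length with values in some compact subinterval of $(0,\infty)$, and such that $N(f_n)\to N(f)$ whenever $f_n,f\in X_{p,q}$ have the same domain $J$ and $f_n\to f$, $f_n^p\to f^p$, and $f_n^q\to f^q$ if $p\neq q$ (resp.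 $f_n^p\ln f_n\to f^p\ln f$ if $p=q$), all in $L^1(J)$. 3. If $pq\le0$ or $\min(p,q)>0$, then $$\mathrm{iHc}(\mathcal G^0_{p,q})=\mathrm{Hc}(\mathcal G_{p,q})=\begin{cases}\left(\dfrac{1-q}{1-p}\right)^{\frac1{p-q}}& p\ne q\text{ and }\min(p,q)\le0\le\max(p,q)<1,\\ e& p=q=0,\\ +\infty&\min(p,q)>0\text{ or }\max(p,q)\ge1.\end{cases}$$ 4. If $\max(p,q)\le0$, then $\mathrm{iHc}(\mathcal G^0_{p,q})\le e$; in particular $\mathrm{iHc}(\mathcal G^0_{p,q})<+\infty$. -/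

import Mathlib

open Set Filter Topology MeasureTheory
open scoped ENNReal

namespace GiniHardy

noncomputable section

/-! ### Weighted means and discrete Gini means -/

/-- An operation `(n, x, w) ↦ M n x w` on `n` entries `x` with `n` real weights `w`. -/
abbrev WeightedOp : Type := (n : ℕ) → (Fin n → ℝ) → (Fin n → ℝ) → ℝ

/-- The weighted Gini mean with parameters `p, q` (used for positive entries and nonnegative
weights, not all zero). -/
def gini (p q : ℝ) : WeightedOp := fun _ x w =>
  if p = q then
    Real.exp ((∑ i, w i * (x i ^ p * Real.log (x i))) / (∑ i, w i * x i ^ p))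
  else
    ((∑ i, w i * x i ^ p) / (∑ i, w i * x i ^ q)) ^ (1 / (p - q))

/-! ### Functional means

A functional mean is given by its domain `X` (a predicate on a bounded interval `J` and a function
`f`, of which only the restriction to `J` matters) and by its value `m J f`. -/

/-- Bounded intervals of positive length. -/
def IsBddInterval (J : Set ℝ) : Prop :=
  J.OrdConnected ∧ Bornology.IsBounded J ∧ (interior J).Nonempty

/-- `f` restricts to an integrable function from `J` to `I`. -/
def InL (I J : Set ℝ) (f : ℝ → ℝ) : Prop := IntegrableOn f J ∧ MapsTo f J I

/-- The smallest closed interval that contains the range of `f` on `J`. -/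
def RG (J : Set ℝ) (f : ℝ → ℝ) : Set ℝ := closure (convexHull ℝ (f '' J))

/-- `m` with domain `X` is an integral mean on `I`: all members of `X` are integrable functions from
a bounded interval to `I`, the value is an element of `I` that satisfies the mean value property,
and the domain and the value do not see changes on null sets. -/
structure IsIntegralMean (I : Set ℝ) (X : Set ℝ → (ℝ → ℝ) → Prop) (m : Set ℝ → (ℝ → ℝ) → ℝ) :
    Prop where
  dom : ∀ J f, X J f → IsBddInterval J ∧ InL I J f
  mem : ∀ J f, X J f → m J f ∈ I
  mean_value : ∀ J f, X J f → m J f ∈ RG J f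
  ae_invariant : ∀ J f g, X J f → InL I J g → f =ᵐ[volume.restrict J] g → X J g ∧ m J f = m J g

/-! ### Simple functions, lower and upper means -/

/-- `g` is an (`ℝ`-)simple function on the interval `J`: there are points
`inf J = c 0 < ⋯ < c n = sup J` such that `g` is equal to `v i` on the part of `J` in
`[c i, c (i + 1))` (for the last piece, `sup J` is included if it belongs to `J`). -/
def IsSimpleOn (J : Set ℝ) (g : ℝ → ℝ) (n : ℕ) (c : Fin (n + 1) → ℝ) (v : Fin n → ℝ) : Prop :=
  StrictMono c ∧ c 0 = sInf J ∧ c (Fin.last n) = sSup J ∧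
    ∀ i : Fin n, ∀ x ∈ J, c i.castSucc ≤ x →
      (x < c i.succ ∨ (i.succ = Fin.last n ∧ x = c (Fin.last n))) → g x = v i

/-- The lengths of the pieces of a partition. -/
def lengths {n : ℕ} (c : Fin (n + 1) → ℝ) : Fin n → ℝ := fun i => c i.succ - c i.castSucc

/-- The values of the weighted mean `M` at all simple functions `g : J → I` with
`|RG g \ RG f| < ε` and `‖f - g‖₁ < ε`. -/
def approxValues (I : Set ℝ) (M : WeightedOp) (J : Set ℝ) (f : ℝ → ℝ) (ε : ℝ) : Set ℝ :=
  {y | ∃ (g : ℝ → ℝ) (n : ℕ) (c : Fin (n + 1) → ℝ) (v : Fin n → ℝ),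
    IsSimpleOn J g n c v ∧ MapsTo g J I ∧
    volume (RG J g \ RG J f) < ENNReal.ofReal ε ∧
    ∫⁻ x in J, ‖f x - g x‖ₑ < ENNReal.ofReal ε ∧
    y = M n v (lengths c)}

/-- The increasing affine map that takes `0` to `inf J` and `1` to `sup J`. -/
def kappa (J : Set ℝ) (s : ℝ) : ℝ := sInf J + s * (sSup J - sInf J)

/-- The lower mean: the limit as `ε → 0` (a supremum, by monotonicity) of the infimum of `M` over
the simple functions that are `ε`-close to `f`, transported to the unit interval. -/
def lowerMean (I : Set ℝ) (M : WeightedOp) (J : Set ℝ) (f : ℝ → ℝ) : EReal :=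
  ⨆ (ε : ℝ) (_ : 0 < ε), ⨅ y ∈ approxValues I M (kappa J ⁻¹' J) (f ∘ kappa J) ε, (y : EReal)

/-- The upper mean. -/
def upperMean (I : Set ℝ) (M : WeightedOp) (J : Set ℝ) (f : ℝ → ℝ) : EReal :=
  ⨅ (ε : ℝ) (_ : 0 < ε), ⨆ y ∈ approxValues I M (kappa J ⁻¹' J) (f ∘ kappa J) ε, (y : EReal)

/-- `f` is an integrable function on a bounded interval `J` whose values lie in some compact
interval `[a, b]` contained in `(0, ∞)`. -/
def InLC (J : Set ℝ) (f : ℝ → ℝ) : Prop :=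
  IsBddInterval J ∧ ∃ a b : ℝ, 0 < a ∧ InL (Icc a b) J f

/-! ### Integral Gini means -/

/-- The explicit integral Gini mean of `f` on `J`. -/
def integralGini (p q : ℝ) (J : Set ℝ) (f : ℝ → ℝ) : ℝ :=
  if p = q then
    Real.exp ((∫ t in J, f t ^ p * Real.log (f t)) / (∫ t in J, f t ^ p))
  else
    ((∫ t in J, f t ^ p) / (∫ t in J, f t ^ q)) ^ (1 / (p - q))

/-- The domain of the integral Gini mean: integrable positive functions on bounded intervals for
which the integrals in the explicit formula exist (and are finite). -/
def giniDom (p q : ℝ) (J : Set ℝ) (f : ℝ → ℝ) : Prop :=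
  IsBddInterval J ∧ InL (Ioi 0) J f ∧ IntegrableOn (fun t => f t ^ p) J ∧
    (p ≠ q → IntegrableOn (fun t => f t ^ q) J) ∧
    (p = q → IntegrableOn (fun t => f t ^ p * Real.log (f t)) J)

/-- Convergence in `L¹ ∩ Lᵖ ∩ L^q` (for `p = q`: in `L¹ ∩ Lᵖ ∩ Lᵖ log L`): the functions themselves
and all the integrands in the explicit formula converge in `L¹(J)`. -/
def GiniTendsto (p q : ℝ) (J : Set ℝ) (F : ℕ → ℝ → ℝ) (f : ℝ → ℝ) : Prop :=
  Tendsto (fun n => ∫⁻ t in J, ‖F n t - f t‖ₑ) atTop (𝓝 0) ∧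
  Tendsto (fun n => ∫⁻ t in J, ‖F n t ^ p - f t ^ p‖ₑ) atTop (𝓝 0) ∧
  (p ≠ q → Tendsto (fun n => ∫⁻ t in J, ‖F n t ^ q - f t ^ q‖ₑ) atTop (𝓝 0)) ∧
  (p = q → Tendsto
    (fun n => ∫⁻ t in J, ‖F n t ^ p * Real.log (F n t) - f t ^ p * Real.log (f t)‖ₑ)
    atTop (𝓝 0))

/-- `N` is a continuous extension of the weighted Gini mean to the domain `giniDom p q`: on functions
with range in a compact part of `(0, ∞)` the lower and the upper mean coincide and are equal to `N`,
and `N` is sequentially continuous on its domain. -/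
def IsContinuousExtension (p q : ℝ) (N : Set ℝ → (ℝ → ℝ) → ℝ) : Prop :=
  (∀ J f, InLC J f →
    lowerMean (Ioi 0) (gini p q) J f = (N J f : EReal) ∧
    upperMean (Ioi 0) (gini p q) J f = (N J f : EReal)) ∧
  (∀ J (F : ℕ → ℝ → ℝ) f, (∀ n, giniDom p q J (F n)) → giniDom p q J f →
    GiniTendsto p q J F f → Tendsto (fun n => N J (F n)) atTop (𝓝 (N J f)))

/-! ### Hardy constants -/

/-- `C` is the (weighted) Hardy constant of `M` on `I`: the smallest extended real with
`∑ wₙ M((x₁,…,xₙ),(w₁,…,wₙ)) ≤ C ∑ wₙ xₙ` for all positive sequences `x` in `I` and `w`. -/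
def IsHardyConst (I : Set ℝ) (M : WeightedOp) (C : ℝ≥0∞) : Prop :=
  IsLeast {H : ℝ≥0∞ | ∀ x w : ℕ → ℝ, (∀ n, 0 < x n ∧ x n ∈ I) → (∀ n, 0 < w n) →
    ∑' n : ℕ, ENNReal.ofReal
        (w n * M (n + 1) (fun i : Fin (n + 1) => x i) (fun i : Fin (n + 1) => w i)) ≤
      H * ∑' n : ℕ, ENNReal.ofReal (w n * x n)} C

/-- `C` is the integral Hardy constant of the functional mean `m` with domain `X` on `I`: the
smallest extended real with `∫₀^∞ m(f|[0,t)) dt ≤ C ∫₀^∞ f(t) dt` for all integrable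
`f : [0, ∞) → I` all of whose restrictions `f|[0,t)` belong to the domain. -/
def IsIntegralHardyConst (I : Set ℝ) (X : Set ℝ → (ℝ → ℝ) → Prop) (m : Set ℝ → (ℝ → ℝ) → ℝ)
    (C : ℝ≥0∞) : Prop :=
  IsLeast {H : ℝ≥0∞ | ∀ f : ℝ → ℝ, InL I (Ici 0) f → (∀ t : ℝ, 0 < t → X (Ico 0 t) f) →
    ∫⁻ t in Ioi (0 : ℝ), ENNReal.ofReal (m (Ico 0 t) f) ≤
      H * ∫⁻ t in Ioi (0 : ℝ), ENNReal.ofReal (f t)} C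

end

end GiniHardy

/-!
For a measure `μ` and a positive function `f`, the Gini mean `m` with parameters `p, q` is the
solution of `∫ f ^ q * φ (f / m) ∂μ = 0`, where `φ z = (z ^ (p - q) - 1) / (p - q)` is the Box–Cox
transform, with `φ = log` if `p = q`. Since `φ` is increasing, comparing `m` with a number amounts
to deciding the sign of such an integral; discrete and integral means are the cases of a weighted
counting measure and of Lebesgue measure.

A function in the domain is the limit of its truncations to compact subintervals of `(0, ∞)`. For
functions with values in a fixed compact subinterval the mean is continuous for convergence in
`L¹`, so the lower and the upper mean both are the limit of the means of simple approximations.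

Hardy's inequality with parameters `p, 0` follows from the tangent line inequality for `φ`: in the
discrete case it makes the weighted means telescope, and in the integral case it bounds the mean
over `(0, t)` by the average of `f` against a kernel that has total mass `1` in `t`. If
`q ≤ 0 ≤ p`, then the mean with parameters `p, q` is a weighted geometric mean of those with
parameters `p, 0` and `q, 0`, and the weighted AM–GM inequality combines the two Hardy inequalities.
If `p, q ≤ 0`, then the mean is at most the geometric mean, for which the constant is `e`.

The constants are sharp for sequences `x n = z ^ n` with weights `w n = z ^ (-n)` as `z → 1`, and
for the functions `s ^ (-a)` near `0` as `a → 1`; the case `p = q = 0` is the limit `p = 0`,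
`q → 0⁻`.
-/

namespace GiniHardy

/-! ### The Box–Cox transform and Gini means -/

section BoxCox

variable {p q r x y z : ℝ}

/-- The Box–Cox transform `(z ^ r - 1) / r`, extended continuously by `log z` at `r = 0`. A Gini
mean with parameters `p, q` is a quasi-arithmetic mean, with varying weights, for the increasing
function `boxCox (p - q)`; this makes no distinction between `p ≠ q` and `p = q`. -/
noncomputable def boxCox (r z : ℝ) : ℝ := if r = 0 then Real.log z else (z ^ r - 1) / r

lemma boxCox_zero (z : ℝ) : boxCox 0 z = Real.log z := if_pos rfl

lemma boxCox_of_ne (hr : r ≠ 0) (z : ℝ) : boxCox r z = (z ^ r - 1) / r := if_neg hr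

lemma boxCox_one (r : ℝ) : boxCox r 1 = 0 := by simp [boxCox]

lemma boxCox_mul (r : ℝ) (hx : 0 < x) (hy : 0 < y) :
    boxCox r (x * y) = boxCox r x + x ^ r * boxCox r y := by
  rcases eq_or_ne r 0 with rfl | hr
  · simp only [boxCox_zero, Real.log_mul hx.ne' hy.ne', Real.rpow_zero, one_mul]
  · simp only [boxCox_of_ne hr, Real.mul_rpow hx.le hy.le]
    ring

lemma strictMonoOn_boxCox (r : ℝ) : StrictMonoOn (boxCox r) (Ioi 0) := by
  intro x hx y _ hxy
  rcases lt_trichotomy r 0 with hr | rfl | hr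
  · rw [boxCox_of_ne hr.ne, boxCox_of_ne hr.ne]
    exact div_lt_div_of_neg_of_lt hr (sub_lt_sub_right (Real.rpow_lt_rpow_of_neg hx hxy hr) 1)
  · simpa only [boxCox_zero] using Real.log_lt_log hx hxy
  · rw [boxCox_of_ne hr.ne', boxCox_of_ne hr.ne']
    have := Real.rpow_lt_rpow (le_of_lt hx) hxy hr
    gcongr

lemma boxCox_nonpos_iff (hz : 0 < z) : boxCox r z ≤ 0 ↔ z ≤ 1 := by
  rw [← boxCox_one r]
  exact (strictMonoOn_boxCox r).le_iff_le hz (mem_Ioi.2 one_pos)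

lemma boxCox_nonneg_iff (hz : 0 < z) : 0 ≤ boxCox r z ↔ 1 ≤ z := by
  rw [← boxCox_one r]
  exact (strictMonoOn_boxCox r).le_iff_le (mem_Ioi.2 one_pos) hz

lemma boxCox_le_log (hr : r ≤ 0) (hz : 0 < z) : boxCox r z ≤ Real.log z := by
  rcases hr.eq_or_lt with rfl | hr
  · rw [boxCox_zero]
  · rw [boxCox_of_ne hr.ne, div_le_iff_of_neg hr, Real.rpow_def_of_pos hz]
    linarith [Real.add_one_le_exp (Real.log z * r)]

lemma boxCox_le_sub_one (hr : r ≤ 1) (hz : 0 < z) : boxCox r z ≤ z - 1 := by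
  rcases le_or_gt r 0 with hr0 | hr0
  · exact (boxCox_le_log hr0 hz).trans (Real.log_le_sub_one_of_pos hz)
  · have bernoulli : z ^ r ≤ 1 + r * (z - 1) := by
      simpa using rpow_one_add_le_one_add_mul_self (s := z - 1) (by linarith) hr0.le hr
    rw [boxCox_of_ne hr0.ne', div_le_iff₀ hr0]
    linarith

lemma boxCox_le_tangent (hr : r ≤ 1) (hx : 0 < x) (hy : 0 < y) :
    boxCox r x ≤ boxCox r y + y ^ r * (x / y - 1) := by
  have cocycle := boxCox_mul r hy (div_pos hx hy)
  rw [mul_div_cancel₀ x hy.ne'] at cocycle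
  rw [cocycle]
  gcongr
  exact boxCox_le_sub_one hr (div_pos hx hy)

lemma rpow_mul_boxCox_sub_comm (hz : 0 < z) (p q : ℝ) :
    z ^ q * boxCox (p - q) z = z ^ p * boxCox (q - p) z := by
  rcases eq_or_ne p q with rfl | hpq
  · rfl
  · rw [boxCox_of_ne (sub_ne_zero.2 hpq), boxCox_of_ne (sub_ne_zero.2 hpq.symm), Real.rpow_sub hz,
      Real.rpow_sub hz]
    have := sub_ne_zero.2 hpq
    have := sub_ne_zero.2 hpq.symm
    have := (Real.rpow_pos_of_pos hz p).ne'
    have := (Real.rpow_pos_of_pos hz q).ne'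
    field_simp
    ring

lemma rpow_mul_boxCox_sub_le_log (hp : p ≤ 0) (hq : q ≤ 0) (hz : 0 < z) :
    z ^ q * boxCox (p - q) z ≤ Real.log z := by
  wlog hpq : p ≤ q generalizing p q
  · rw [rpow_mul_boxCox_sub_comm hz]
    exact this hq hp (le_of_not_ge hpq)
  refine le_trans ?_ (boxCox_le_log (sub_nonpos.2 hpq) hz)
  rcases le_total z 1 with hz1 | hz1
  · exact mul_le_of_one_le_left ((boxCox_nonpos_iff hz).2 hz1)
      (Real.one_le_rpow_of_pos_of_le_one_of_nonpos hz hz1 hq)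
  · exact mul_le_of_le_one_left ((boxCox_nonneg_iff hz).2 hz1)
      (Real.rpow_le_one_of_one_le_of_nonpos hz1 hq)

end BoxCox

section GiniMean

variable {α : Type*} [MeasurableSpace α] {μ : Measure α} {f : α → ℝ} {p q y : ℝ}

lemma integral_pos_of_ae_pos (hμ : μ ≠ 0) (hf : Integrable f μ) (hpos : ∀ᵐ x ∂μ, 0 < f x) :
    0 < ∫ x, f x ∂μ := by
  have hnonneg : 0 ≤ᵐ[μ] f := hpos.mono fun x hx => hx.le
  refine (integral_nonneg_of_ae hnonneg).lt_of_ne' fun hzero => ?_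
  have : NeZero μ := ⟨hμ⟩
  obtain ⟨x, hx, hx0⟩ :=
    (hpos.and ((integral_eq_zero_iff_of_nonneg_ae hnonneg hf).1 hzero)).exists
  exact hx.ne' hx0

/-- The Gini mean of `f` with respect to the measure `μ`. Lebesgue measure on an interval gives
`integralGini`, a weighted sum of point masses gives `gini`. -/
noncomputable def giniMean (p q : ℝ) (μ : Measure α) (f : α → ℝ) : ℝ :=
  if p = q then
    Real.exp ((∫ x, f x ^ p * Real.log (f x) ∂μ) / ∫ x, f x ^ p ∂μ)
  else
    ((∫ x, f x ^ p ∂μ) / ∫ x, f x ^ q ∂μ) ^ (1 / (p - q))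

lemma giniMean_nonneg (hf : ∀ᵐ x ∂μ, 0 ≤ f x) : 0 ≤ giniMean p q μ f := by
  have integral_rpow_nonneg (s : ℝ) : 0 ≤ ∫ x, f x ^ s ∂μ :=
    integral_nonneg_of_ae (hf.mono fun x hx => Real.rpow_nonneg hx s)
  unfold giniMean
  split_ifs
  · exact (Real.exp_pos _).le
  · exact Real.rpow_nonneg (div_nonneg (integral_rpow_nonneg p) (integral_rpow_nonneg q)) _

/-- The conditions under which `giniMean p q μ f` is a genuine mean: `μ` is nonzero, `f` is positive
and the integrands in the formula are integrable. -/
structure GiniIntegrable (p q : ℝ) (μ : Measure α) (f : α → ℝ) : Prop where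
  ne_zero : μ ≠ 0
  pos : ∀ᵐ x ∂μ, 0 < f x
  left : Integrable (fun x => f x ^ p) μ
  right : Integrable (fun x => f x ^ q) μ
  log : p = q → Integrable (fun x => f x ^ p * Real.log (f x)) μ

namespace GiniIntegrable

lemma symm (h : GiniIntegrable p q μ f) : GiniIntegrable q p μ f :=
  ⟨h.ne_zero, h.pos, h.right, h.left, fun hqp => hqp ▸ h.log hqp.symm⟩

lemma integral_left_pos (h : GiniIntegrable p q μ f) : 0 < ∫ x, f x ^ p ∂μ := by
  have pow_pos : ∀ᵐ x ∂μ, 0 < f x ^ p := h.pos.mono fun x hx => Real.rpow_pos_of_pos hx p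
  exact integral_pos_of_ae_pos h.ne_zero h.left pow_pos

lemma integral_right_pos (h : GiniIntegrable p q μ f) : 0 < ∫ x, f x ^ q ∂μ :=
  h.symm.integral_left_pos

lemma giniMean_pos (h : GiniIntegrable p q μ f) : 0 < giniMean p q μ f := by
  unfold giniMean
  split_ifs
  · exact Real.exp_pos _
  · exact Real.rpow_pos_of_pos (div_pos h.integral_left_pos h.integral_right_pos) _

lemma giniMean_rpow_sub (h : GiniIntegrable p q μ f) (hpq : p ≠ q) :
    giniMean p q μ f ^ (p - q) = (∫ x, f x ^ p ∂μ) / ∫ x, f x ^ q ∂μ := by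
  rw [giniMean, if_neg hpq, ← Real.rpow_mul (div_pos h.integral_left_pos h.integral_right_pos).le,
    one_div_mul_cancel (sub_ne_zero.2 hpq), Real.rpow_one]

lemma giniMean_comm (h : GiniIntegrable p q μ f) : giniMean p q μ f = giniMean q p μ f := by
  rcases eq_or_ne p q with rfl | hpq
  · rfl
  · rw [giniMean, giniMean, if_neg hpq, if_neg hpq.symm, ← inv_div (∫ x, f x ^ p ∂μ),
      Real.inv_rpow (div_pos h.integral_left_pos h.integral_right_pos).le, ← Real.rpow_neg
      (div_pos h.integral_left_pos h.integral_right_pos).le]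
    congr 1
    rw [← one_div_neg_eq_neg_one_div, neg_sub]

lemma rpow_mul_boxCox_div_ae_eq (h : GiniIntegrable p q μ f) (hy : 0 < y) :
    (fun x => f x ^ q * boxCox (p - q) (f x / y)) =ᵐ[μ] fun x =>
      if p = q then f x ^ p * Real.log (f x) - Real.log y * f x ^ p
      else (p - q)⁻¹ * (y ^ (q - p) * f x ^ p - f x ^ q) := by
  filter_upwards [h.pos] with x hx
  split_ifs with hpq
  · rw [hpq, sub_self, boxCox_zero, Real.log_div hx.ne' hy.ne']
    ring
  · rw [boxCox_of_ne (sub_ne_zero.2 hpq), Real.div_rpow hx.le hy.le, ← neg_sub p q,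
      Real.rpow_neg hy.le, Real.rpow_sub hx]
    have := (Real.rpow_pos_of_pos hx q).ne'
    field_simp

lemma integrable_rpow_mul_boxCox_div (h : GiniIntegrable p q μ f) (hy : 0 < y) :
    Integrable (fun x => f x ^ q * boxCox (p - q) (f x / y)) μ := by
  refine Integrable.congr ?_ (h.rpow_mul_boxCox_div_ae_eq hy).symm
  split_ifs with hpq
  · exact (h.log hpq).sub (h.left.const_mul _)
  · exact ((h.left.const_mul _).sub h.right).const_mul _

/-- The Gini mean is the solution `m` of `∫ f ^ q * boxCox (p - q) (f / m) = 0`: apply this identity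
with `y = m`. -/
lemma integral_rpow_mul_boxCox_div (h : GiniIntegrable p q μ f) (hy : 0 < y) :
    ∫ x, f x ^ q * boxCox (p - q) (f x / y) ∂μ =
      (∫ x, f x ^ q ∂μ) * boxCox (p - q) (giniMean p q μ f / y) := by
  rw [integral_congr_ae (h.rpow_mul_boxCox_div_ae_eq hy)]
  have hq := h.integral_right_pos.ne'
  split_ifs with hpq
  · subst hpq
    rw [sub_self, boxCox_zero, Real.log_div h.giniMean_pos.ne' hy.ne', giniMean, if_pos rfl,
      Real.log_exp, integral_sub (h.log rfl) (h.left.const_mul _), integral_const_mul]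
    field_simp
  · rw [boxCox_of_ne (sub_ne_zero.2 hpq), Real.div_rpow h.giniMean_pos.le hy.le,
      h.giniMean_rpow_sub hpq, integral_const_mul, integral_sub (h.left.const_mul _) h.right,
      integral_const_mul, ← neg_sub p q, Real.rpow_neg hy.le]
    field_simp

lemma giniMean_le_iff (h : GiniIntegrable p q μ f) (hy : 0 < y) :
    giniMean p q μ f ≤ y ↔ ∫ x, f x ^ q * boxCox (p - q) (f x / y) ∂μ ≤ 0 := by
  rw [h.integral_rpow_mul_boxCox_div hy, ← neg_nonneg, ← mul_neg,
    mul_nonneg_iff_of_pos_left h.integral_right_pos, neg_nonneg,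
    boxCox_nonpos_iff (div_pos h.giniMean_pos hy), div_le_one hy]

lemma le_giniMean_iff (h : GiniIntegrable p q μ f) (hy : 0 < y) :
    y ≤ giniMean p q μ f ↔ 0 ≤ ∫ x, f x ^ q * boxCox (p - q) (f x / y) ∂μ := by
  rw [h.integral_rpow_mul_boxCox_div hy, mul_nonneg_iff_of_pos_left h.integral_right_pos,
    boxCox_nonneg_iff (div_pos h.giniMean_pos hy), one_le_div hy]

lemma giniMean_le_of_ae_le (h : GiniIntegrable p q μ f) (hf : ∀ᵐ x ∂μ, f x ≤ y) :
    giniMean p q μ f ≤ y := by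
  have : NeZero μ := ⟨h.ne_zero⟩
  obtain ⟨x, hx, hxy⟩ := (h.pos.and hf).exists
  have hy := hx.trans_le hxy
  refine (h.giniMean_le_iff hy).2 (integral_nonpos_of_ae ?_)
  filter_upwards [h.pos, hf] with x hx hxy
  exact mul_nonpos_of_nonneg_of_nonpos (Real.rpow_nonneg hx.le q)
    ((boxCox_nonpos_iff (div_pos hx hy)).2 ((div_le_one hy).2 hxy))

lemma le_giniMean_of_ae_le (h : GiniIntegrable p q μ f) (hf : ∀ᵐ x ∂μ, y ≤ f x) :
    y ≤ giniMean p q μ f := by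
  rcases le_or_gt y 0 with hy | hy
  · exact hy.trans h.giniMean_pos.le
  refine (h.le_giniMean_iff hy).2 (integral_nonneg_of_ae ?_)
  filter_upwards [h.pos, hf] with x hx hyx
  exact mul_nonneg (Real.rpow_nonneg hx.le q)
    ((boxCox_nonneg_iff (div_pos hx hy)).2 ((one_le_div hy).2 hyx))

lemma giniMean_le_giniMean_zero_zero (h : GiniIntegrable p q μ f) (h₀ : GiniIntegrable 0 0 μ f)
    (hp : p ≤ 0) (hq : q ≤ 0) : giniMean p q μ f ≤ giniMean 0 0 μ f := by
  have hy := h₀.giniMean_pos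
  set y := giniMean 0 0 μ f with hy_def
  have log_eq_zero : ∫ x, Real.log (f x / y) ∂μ = 0 := by
    have := h₀.integral_rpow_mul_boxCox_div hy
    simpa [boxCox_zero, ← hy_def, hy.ne'] using this
  have log_int : Integrable (fun x => Real.log (f x / y)) μ := by
    simpa [boxCox_zero] using h₀.integrable_rpow_mul_boxCox_div hy
  rw [h.giniMean_le_iff hy]
  refine nonpos_of_mul_nonpos_right (a := y ^ (-q)) ?_ (Real.rpow_pos_of_pos hy (-q))
  rw [← integral_const_mul, ← log_eq_zero]
  refine integral_mono_ae ((h.integrable_rpow_mul_boxCox_div hy).const_mul _) log_int ?_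
  filter_upwards [h.pos] with x hx
  calc y ^ (-q) * (f x ^ q * boxCox (p - q) (f x / y))
      = (f x / y) ^ q * boxCox (p - q) (f x / y) := by
        rw [Real.div_rpow hx.le hy.le, Real.rpow_neg hy.le]; ring
    _ ≤ Real.log (f x / y) := rpow_mul_boxCox_sub_le_log hp hq (div_pos hx hy)

lemma giniMean_zero_rpow (h : GiniIntegrable p 0 μ f) :
    giniMean p 0 μ f ^ p = (∫ x, f x ^ p ∂μ) / μ.real univ := by
  rcases eq_or_ne p 0 with rfl | hp
  · have := h.integral_right_pos
    simp_all [ne_of_gt]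
  · simpa using h.giniMean_rpow_sub hp

/-- For `q ≤ 0 ≤ p` the exponents are nonnegative with sum `1`. -/
lemma giniMean_eq_mul (h : GiniIntegrable p q μ f) (hp : GiniIntegrable p 0 μ f)
    (hq : GiniIntegrable q 0 μ f) (hpq : p ≠ q) :
    giniMean p q μ f =
      giniMean p 0 μ f ^ (p / (p - q)) * giniMean q 0 μ f ^ (-q / (p - q)) := by
  have hμ : 0 < μ.real univ := by simpa using hp.integral_right_pos
  have hp0 := h.integral_left_pos
  have hq0 := h.integral_right_pos
  rw [giniMean, if_neg hpq, ← mul_one_div p, ← mul_one_div (-q), Real.rpow_mul hp.giniMean_pos.le,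
    Real.rpow_mul hq.giniMean_pos.le, Real.rpow_neg hq.giniMean_pos.le, hp.giniMean_zero_rpow,
    hq.giniMean_zero_rpow, ← Real.mul_rpow (by positivity) (by positivity)]
  congr 1
  field_simp

end GiniIntegrable

lemma giniMean_smul_measure {c : ℝ≥0∞} (hc₀ : c ≠ 0) (hc : c ≠ ⊤) :
    giniMean p q (c • μ) f = giniMean p q μ f := by
  have hc' : c.toReal ≠ 0 := ENNReal.toReal_ne_zero.2 ⟨hc₀, hc⟩
  simp only [giniMean, integral_smul_measure, smul_eq_mul, mul_div_mul_left _ _ hc']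

lemma giniMean_map {β : Type*} [MeasurableSpace β] {e : β → α} (he : MeasurableEmbedding e)
    {ν : Measure β} : giniMean p q (ν.map e) f = giniMean p q ν (f ∘ e) := by
  simp only [giniMean, he.integral_map, Function.comp_apply]

lemma giniMean_congr_ae {g : α → ℝ} (hfg : f =ᵐ[μ] g) : giniMean p q μ f = giniMean p q μ g := by
  have integral_congr (φ : ℝ → ℝ) : ∫ x, φ (f x) ∂μ = ∫ x, φ (g x) ∂μ :=
    integral_congr_ae (hfg.fun_comp φ)
  rw [giniMean, giniMean, integral_congr fun z => z ^ p * Real.log z, integral_congr (· ^ p),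
    integral_congr (· ^ q)]

lemma tendsto_giniMean {ι : Type*} {l : Filter ι} {ν : ι → Measure α} {F : ι → α → ℝ}
    (h : GiniIntegrable p q μ f)
    (hp : Tendsto (fun i => ∫ x, F i x ^ p ∂ν i) l (𝓝 (∫ x, f x ^ p ∂μ)))
    (hq : p ≠ q → Tendsto (fun i => ∫ x, F i x ^ q ∂ν i) l (𝓝 (∫ x, f x ^ q ∂μ)))
    (hlog : p = q → Tendsto (fun i => ∫ x, F i x ^ p * Real.log (F i x) ∂ν i) l
      (𝓝 (∫ x, f x ^ p * Real.log (f x) ∂μ))) :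
    Tendsto (fun i => giniMean p q (ν i) (F i)) l (𝓝 (giniMean p q μ f)) := by
  unfold giniMean
  split_ifs with hpq
  · exact (Real.continuous_exp.tendsto _).comp ((hlog hpq).div hp h.integral_left_pos.ne')
  · exact (hp.div (hq hpq) h.integral_right_pos.ne').rpow_const
      (.inl (div_pos h.integral_left_pos h.integral_right_pos).ne')

end GiniMean

/-! ### Integral Gini means -/

section Intervals

variable {J : Set ℝ} {f : ℝ → ℝ}

namespace IsBddInterval

lemma measurableSet (hJ : IsBddInterval J) : MeasurableSet J :=
  hJ.1.measurableSet

lemma volume_lt_top (hJ : IsBddInterval J) : volume J < ⊤ :=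
  hJ.2.1.measure_lt_top

lemma volume_pos (hJ : IsBddInterval J) : 0 < volume J :=
  Measure.measure_pos_of_nonempty_interior volume hJ.2.2

lemma nonempty (hJ : IsBddInterval J) : J.Nonempty :=
  hJ.2.2.mono interior_subset

lemma subset_Icc (hJ : IsBddInterval J) : J ⊆ Icc (sInf J) (sSup J) :=
  fun _ hx => ⟨csInf_le hJ.2.1.bddBelow hx, le_csSup hJ.2.1.bddAbove hx⟩

lemma Ioo_subset (hJ : IsBddInterval J) : Ioo (sInf J) (sSup J) ⊆ J := by
  intro x hx
  obtain ⟨y, hy, hyx⟩ := exists_lt_of_csInf_lt hJ.nonempty hx.1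
  obtain ⟨z, hz, hxz⟩ := exists_lt_of_lt_csSup hJ.nonempty hx.2
  exact hJ.1.out hy hz ⟨hyx.le, hxz.le⟩

lemma sInf_lt_sSup (hJ : IsBddInterval J) : sInf J < sSup J := by
  by_contra! h
  refine hJ.volume_pos.not_ge ?_
  calc volume J ≤ volume (Icc (sInf J) (sSup J)) := measure_mono hJ.subset_Icc
    _ = 0 := by rw [Real.volume_Icc, ENNReal.ofReal_of_nonpos (sub_nonpos.2 h)]

lemma ae_eq_Ioc (hJ : IsBddInterval J) : J =ᵐ[volume] Ioc (sInf J) (sSup J) :=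
  (hJ.subset_Icc.eventuallyLE.trans Ioc_ae_eq_Icc.symm.le).antisymm
    (Ioo_ae_eq_Ioc.symm.le.trans hJ.Ioo_subset.eventuallyLE)

lemma integrableOn_of_bound (hJ : IsBddInterval J)
    (hf : AEStronglyMeasurable f (volume.restrict J)) {K : ℝ} (hK : ∀ t ∈ J, |f t| ≤ K) :
    IntegrableOn f J := by
  have : IsFiniteMeasure (volume.restrict J) := ⟨by simpa using hJ.volume_lt_top⟩
  exact Integrable.of_bound hf K (ae_restrict_of_forall_mem hJ.measurableSet hK)

end IsBddInterval

lemma isBddInterval_of_Ioo_subset {a b : ℝ} (hab : a < b) (hJ : J.OrdConnected)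
    (hIoo : Ioo a b ⊆ J) (hIcc : J ⊆ Icc a b) :
    IsBddInterval J ∧ sInf J = a ∧ sSup J = b := by
  have hne : (Ioo a b).Nonempty := nonempty_Ioo.2 hab
  have hbdd : Bornology.IsBounded J := (Metric.isBounded_Icc a b).subset hIcc
  refine ⟨⟨hJ, hbdd, hne.mono (interior_maximal hIoo isOpen_Ioo)⟩, ?_, ?_⟩
  · refine le_antisymm ?_ (le_csInf (hne.mono hIoo) fun x hx => (hIcc hx).1)
    exact (csInf_le_csInf hbdd.bddBelow hne hIoo).trans_eq (csInf_Ioo hab)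
  · refine le_antisymm (csSup_le (hne.mono hIoo) fun x hx => (hIcc hx).2) ?_
    exact (csSup_Ioo hab).symm.trans_le (csSup_le_csSup hbdd.bddAbove hne hIoo)

lemma isBddInterval_Ico {a b : ℝ} (hab : a < b) : IsBddInterval (Ico a b) :=
  (isBddInterval_of_Ioo_subset hab ordConnected_Ico Ioo_subset_Ico_self Ico_subset_Icc_self).1

end Intervals

section IntegralGini

variable {J : Set ℝ} {p q : ℝ} {f : ℝ → ℝ}

lemma integralGini_eq_giniMean (p q : ℝ) (J : Set ℝ) (f : ℝ → ℝ) :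
    integralGini p q J f = giniMean p q (volume.restrict J) f := rfl

namespace giniDom

lemma giniIntegrable (h : giniDom p q J f) : GiniIntegrable p q (volume.restrict J) f where
  ne_zero h₀ := h.1.volume_pos.ne' (Measure.restrict_eq_zero.1 h₀)
  pos := ae_restrict_of_forall_mem h.1.measurableSet h.2.1.2
  left := h.2.2.1
  right := by
    rcases eq_or_ne p q with rfl | hpq
    · exact h.2.2.1
    · exact h.2.2.2.1 hpq
  log := h.2.2.2.2

lemma symm (h : giniDom p q J f) : giniDom q p J f :=
  have h' := h.giniIntegrable.symm
  ⟨h.1, h.2.1, h'.left, fun _ => h'.right, h'.log⟩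

end giniDom

lemma integralGini_comm (h : giniDom p q J f) : integralGini p q J f = integralGini q p J f :=
  h.giniIntegrable.giniMean_comm

lemma mem_closure_convexHull {S : Set ℝ} {m : ℝ} (hS : S.Nonempty)
    (hlower : ∀ a, (∀ x ∈ S, a ≤ x) → a ≤ m) (hupper : ∀ b, (∀ x ∈ S, x ≤ b) → m ≤ b) :
    m ∈ closure (convexHull ℝ S) := by
  have hsub : S ⊆ closure (convexHull ℝ S) := (subset_convexHull ℝ S).trans subset_closure
  by_cases hub : ∀ x ∈ S, x ≤ m
  · have hm : IsLUB S m := ⟨hub, fun b hb => hupper b fun x hx => hb hx⟩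
    exact closure_mono (subset_convexHull ℝ S) (hm.mem_closure hS)
  by_cases hlb : ∀ x ∈ S, m ≤ x
  · have hm : IsGLB S m := ⟨hlb, fun b hb => hlower b fun x hx => hb hx⟩
    exact closure_mono (subset_convexHull ℝ S) (hm.mem_closure hS)
  push Not at hub hlb
  obtain ⟨y, hy, hmy⟩ := hub
  obtain ⟨z, hz, hzm⟩ := hlb
  exact (convex_convexHull ℝ S).closure.ordConnected.out (hsub hz) (hsub hy) ⟨hzm.le, hmy.le⟩

lemma integralGini_mem_RG (h : giniDom p q J f) : integralGini p q J f ∈ RG J f := by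
  have ae_of_forall_image {P : ℝ → Prop} (hP : ∀ x ∈ f '' J, P x) :
      ∀ᵐ t ∂volume.restrict J, P (f t) :=
    ae_restrict_of_forall_mem h.1.measurableSet fun t ht => hP _ (mem_image_of_mem f ht)
  exact mem_closure_convexHull (h.1.nonempty.image f)
    (fun a ha => h.giniIntegrable.le_giniMean_of_ae_le (ae_of_forall_image ha))
    (fun b hb => h.giniIntegrable.giniMean_le_of_ae_le (ae_of_forall_image hb))

theorem isIntegralMean_integralGini (p q : ℝ) :
    IsIntegralMean (Ioi 0) (giniDom p q) (integralGini p q) where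
  dom _ _ h := ⟨h.1, h.2.1⟩
  mem _ _ h := h.giniIntegrable.giniMean_pos
  mean_value _ _ h := integralGini_mem_RG h
  ae_invariant J f g h hg hfg := by
    have congr {φ : ℝ → ℝ} (hφ : IntegrableOn (fun t => φ (f t)) J) :
        IntegrableOn (fun t => φ (g t)) J := hφ.congr_fun_ae (hfg.fun_comp φ)
    exact ⟨⟨h.1, hg, congr (φ := (· ^ p)) h.2.2.1, fun hpq => congr (φ := (· ^ q)) (h.2.2.2.1 hpq),
      fun hpq => congr (φ := fun x => x ^ p * Real.log x) (h.2.2.2.2 hpq)⟩, giniMean_congr_ae hfg⟩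

lemma tendsto_integralGini {F : ℕ → ℝ → ℝ} (hF : ∀ n, giniDom p q J (F n)) (hf : giniDom p q J f)
    (h : GiniTendsto p q J F f) :
    Tendsto (fun n => integralGini p q J (F n)) atTop (𝓝 (integralGini p q J f)) :=
  tendsto_giniMean hf.giniIntegrable
    (tendsto_integral_of_L1 _ hf.2.2.1.aestronglyMeasurable (.of_forall fun n => (hF n).2.2.1)
      h.2.1)
    (fun hpq => tendsto_integral_of_L1 _ (hf.2.2.2.1 hpq).aestronglyMeasurable
      (.of_forall fun n => (hF n).2.2.2.1 hpq) (h.2.2.1 hpq))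
    (fun hpq => tendsto_integral_of_L1 _ (hf.2.2.2.2 hpq).aestronglyMeasurable
      (.of_forall fun n => (hF n).2.2.2.2 hpq) (h.2.2.2 hpq))

end IntegralGini

section Simple

variable {J : Set ℝ} {g : ℝ → ℝ} {n : ℕ} {c : Fin (n + 1) → ℝ} {v : Fin n → ℝ}

lemma intervalIntegrable_and_integral_eq_sum_fin
    (hg : ∀ i : Fin n, IntervalIntegrable g volume (c i.castSucc) (c i.succ)) :
    IntervalIntegrable g volume (c 0) (c (Fin.last n)) ∧
      ∫ t in c 0..c (Fin.last n), g t = ∑ i : Fin n, ∫ t in c i.castSucc..c i.succ, g t := by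
  induction n with
  | zero => simp
  | succ n ih =>
    obtain ⟨h_int, hsum⟩ := ih (c := fun i => c i.castSucc) fun i => hg i.castSucc
    have hlast := hg (Fin.last n)
    refine ⟨h_int.trans hlast, ?_⟩
    rw [Fin.sum_univ_castSucc]
    exact (intervalIntegral.integral_add_adjacent_intervals h_int hlast).symm.trans
      (congrArg (· + _) hsum)

namespace IsSimpleOn

lemma comp (h : IsSimpleOn J g n c v) (φ : ℝ → ℝ) :
    IsSimpleOn J (fun t => φ (g t)) n c (fun i => φ (v i)) :=
  ⟨h.1, h.2.1, h.2.2.1, fun i x hx hcx hxc => congrArg φ (h.2.2.2 i x hx hcx hxc)⟩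

lemma eq_of_mem_Ioo (hJ : IsBddInterval J) (h : IsSimpleOn J g n c v) (i : Fin n) {x : ℝ}
    (hx : x ∈ Ioo (c i.castSucc) (c i.succ)) : g x = v i := by
  have hleft : sInf J ≤ c i.castSucc := h.2.1 ▸ h.1.monotone (Fin.zero_le _)
  have hright : c i.succ ≤ sSup J := h.2.2.1 ▸ h.1.monotone (Fin.le_last _)
  exact h.2.2.2 i x (hJ.Ioo_subset ⟨hleft.trans_lt hx.1, hx.2.trans_le hright⟩) hx.1.le (.inl hx.2)

lemma integrableOn_and_integral_eq (hJ : IsBddInterval J) (h : IsSimpleOn J g n c v) :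
    IntegrableOn g J ∧ ∫ t in J, g t = ∑ i, lengths c i * v i := by
  have hle (i : Fin n) : c i.castSucc ≤ c i.succ := (h.1 Fin.castSucc_lt_succ).le
  have hae (i : Fin n) : (fun _ => v i) =ᵐ[volume.restrict (Ioc (c i.castSucc) (c i.succ))] g := by
    rw [← restrict_Ioo_eq_restrict_Ioc]
    exact ae_restrict_of_forall_mem measurableSet_Ioo fun x hx => (h.eq_of_mem_Ioo hJ i hx).symm
  have hpiece (i : Fin n) : ∫ t in c i.castSucc..c i.succ, g t = lengths c i * v i := by
    rw [intervalIntegral.integral_of_le (hle i), ← integral_congr_ae (hae i)]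
    simp [lengths, hle i]
  obtain ⟨h_int, hsum⟩ := intervalIntegrable_and_integral_eq_sum_fin (g := g) (c := c) fun i => by
    rw [intervalIntegrable_iff_integrableOn_Ioc_of_le (hle i)]
    exact (integrableOn_const (by simp) (by simp)).congr (hae i)
  have hJle := hJ.sInf_lt_sSup.le
  rw [h.2.1, h.2.2.1] at h_int hsum
  rw [intervalIntegrable_iff_integrableOn_Ioc_of_le hJle] at h_int
  refine ⟨h_int.congr_set_ae hJ.ae_eq_Ioc, ?_⟩
  rw [setIntegral_congr_set hJ.ae_eq_Ioc, ← intervalIntegral.integral_of_le hJle, hsum]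
  simp only [hpiece]

lemma giniDom (p q : ℝ) (hJ : IsBddInterval J) (hg : MapsTo g J (Ioi 0))
    (h : IsSimpleOn J g n c v) : giniDom p q J g :=
  ⟨hJ, ⟨(h.integrableOn_and_integral_eq hJ).1, hg⟩,
    ((h.comp (· ^ p)).integrableOn_and_integral_eq hJ).1,
    fun _ => ((h.comp (· ^ q)).integrableOn_and_integral_eq hJ).1,
    fun _ => ((h.comp fun x => x ^ p * Real.log x).integrableOn_and_integral_eq hJ).1⟩

lemma integralGini_eq (p q : ℝ) (hJ : IsBddInterval J) (h : IsSimpleOn J g n c v) :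
    integralGini p q J g = gini p q n v (lengths c) := by
  rw [integralGini, gini, ((h.comp (· ^ p)).integrableOn_and_integral_eq hJ).2,
    ((h.comp (· ^ q)).integrableOn_and_integral_eq hJ).2,
    ((h.comp fun x => x ^ p * Real.log x).integrableOn_and_integral_eq hJ).2]

end IsSimpleOn

end Simple

section Truncation

variable {J : Set ℝ} {p q : ℝ} {f φ : ℝ → ℝ}

lemma contDiffOn_rpow (p : ℝ) : ContDiffOn ℝ 1 (fun x : ℝ => x ^ p) (Ioi 0) :=
  contDiffOn_id.rpow_const_of_ne fun _ hx => (mem_Ioi.1 hx).ne'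

lemma contDiffOn_rpow_mul_log (p : ℝ) :
    ContDiffOn ℝ 1 (fun x : ℝ => x ^ p * Real.log x) (Ioi 0) :=
  (contDiffOn_rpow p).mul (contDiffOn_id.log fun _ hx => (mem_Ioi.1 hx).ne')

lemma InLC.integrableOn_comp (hφm : Measurable φ) (hφ : ContinuousOn φ (Ioi 0)) (h : InLC J f) :
    IntegrableOn (fun t => φ (f t)) J := by
  obtain ⟨hJ, a, b, ha, hf, hmaps⟩ := h
  have hcont : ContinuousOn φ (Icc a b) := hφ.mono fun x hx => ha.trans_le hx.1
  obtain ⟨K, hK⟩ := isCompact_Icc.exists_bound_of_continuousOn hcont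
  exact hJ.integrableOn_of_bound
    (hφm.comp_aemeasurable hf.aestronglyMeasurable.aemeasurable).aestronglyMeasurable
    fun t ht => hK _ (hmaps ht)

lemma measurable_rpow_const (p : ℝ) : Measurable fun x : ℝ => x ^ p := measurable_id.pow_const p

lemma measurable_rpow_mul_log (p : ℝ) : Measurable fun x : ℝ => x ^ p * Real.log x :=
  (measurable_rpow_const p).mul Real.measurable_log

lemma InLC.giniDom (p q : ℝ) (h : InLC J f) : giniDom p q J f := by
  have hr (r : ℝ) : IntegrableOn (fun t => f t ^ r) J :=
    h.integrableOn_comp (measurable_rpow_const r) (contDiffOn_rpow r).continuousOn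
  refine ⟨h.1, ?_, hr p, fun _ => hr q,
    fun _ => h.integrableOn_comp (measurable_rpow_mul_log p)
      (contDiffOn_rpow_mul_log p).continuousOn⟩
  obtain ⟨-, a, b, ha, hf, hmaps⟩ := h
  exact ⟨hf, fun t ht => ha.trans_le (hmaps ht).1⟩

/-- `truncate n x` replaces the values outside `[1 / (n + 1), n + 1]` by `1`. Cutting off to a
constant instead of to the nearest end point gives `|φ (truncate n x)| ≤ |φ x| + |φ 1|` for every
function `φ`, so that one dominated convergence argument covers all the integrands. -/
noncomputable def truncate (n : ℕ) (x : ℝ) : ℝ :=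
  if x ∈ Icc (1 / ((n : ℝ) + 1)) (n + 1) then x else 1

lemma truncate_mem_Icc (n : ℕ) (x : ℝ) : truncate n x ∈ Icc (1 / ((n : ℝ) + 1)) (n + 1) := by
  unfold truncate
  split_ifs with hx
  · exact hx
  · have hn : (1 : ℝ) ≤ n + 1 := by simp
    exact ⟨div_le_one_of_le₀ hn (by positivity), hn⟩

lemma measurable_truncate (n : ℕ) : Measurable (truncate n) :=
  Measurable.ite measurableSet_Icc measurable_id measurable_const

lemma abs_comp_truncate_le (φ : ℝ → ℝ) (n : ℕ) (x : ℝ) : |φ (truncate n x)| ≤ |φ x| + |φ 1| := by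
  unfold truncate
  split_ifs <;> simp

lemma eventually_truncate_eq {x : ℝ} (hx : 0 < x) : ∀ᶠ n in atTop, truncate n x = x := by
  obtain ⟨N, hN⟩ := exists_nat_one_div_lt hx
  obtain ⟨K, hK⟩ := exists_nat_ge x
  filter_upwards [eventually_ge_atTop N, eventually_ge_atTop K] with n hNn hKn
  have hKn' : (K : ℝ) ≤ n := by exact_mod_cast hKn
  exact if_pos ⟨(Nat.one_div_le_one_div hNn).trans hN.le, by linarith⟩

namespace giniDom

lemma inLC_truncate (h : giniDom p q J f) (n : ℕ) : InLC J (fun t => truncate n (f t)) := by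
  refine ⟨h.1, 1 / ((n : ℝ) + 1), n + 1, by positivity, ?_, fun t _ => truncate_mem_Icc n _⟩
  refine h.1.integrableOn_of_bound (K := (n : ℝ) + 1) ((measurable_truncate n).comp_aemeasurable
    h.2.1.1.aestronglyMeasurable.aemeasurable).aestronglyMeasurable fun t _ => ?_
  obtain ⟨hlower, hupper⟩ := truncate_mem_Icc n (f t)
  exact abs_le.2 ⟨by linarith [show (0 : ℝ) < 1 / (n + 1) by positivity], hupper⟩

lemma tendsto_lintegral_comp_truncate (h : giniDom p q J f) (hφ : Measurable φ)
    (h_int : IntegrableOn (fun t => φ (f t)) J) :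
    Tendsto (fun n => ∫⁻ t in J, ‖φ (truncate n (f t)) - φ (f t)‖ₑ) atTop (𝓝 0) := by
  have hJ := h.1.measurableSet
  have hbound : IntegrableOn (fun t => |φ (f t)| + |φ 1|) J :=
    h_int.abs.add (integrableOn_const h.1.volume_lt_top.ne)
  simp_rw [← ofReal_norm]
  refine tendsto_lintegral_norm_of_dominated_convergence (fun n => ?_) hbound.hasFiniteIntegral
    (fun n => ae_of_all _ fun t => abs_comp_truncate_le φ n (f t)) ?_
  · exact (hφ.comp_aemeasurable ((measurable_truncate n).comp_aemeasurable
      h.2.1.1.aestronglyMeasurable.aemeasurable)).aestronglyMeasurable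
  · refine ae_restrict_of_forall_mem hJ fun t ht => tendsto_const_nhds.congr' ?_
    filter_upwards [eventually_truncate_eq (h.2.1.2 ht)] with n hn
    rw [hn]

lemma giniTendsto_truncate (h : giniDom p q J f) :
    GiniTendsto p q J (fun n t => truncate n (f t)) f := by
  exact ⟨h.tendsto_lintegral_comp_truncate (φ := fun x => x) measurable_id h.2.1.1,
    h.tendsto_lintegral_comp_truncate (φ := (· ^ p)) (measurable_rpow_const p) h.2.2.1,
    fun hpq => h.tendsto_lintegral_comp_truncate (φ := (· ^ q)) (measurable_rpow_const q)
      (h.2.2.2.1 hpq),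
    fun hpq => h.tendsto_lintegral_comp_truncate (φ := fun x => x ^ p * Real.log x)
      (measurable_rpow_mul_log p) (h.2.2.2.2 hpq)⟩

end giniDom

end Truncation

section Transport

variable {J : Set ℝ} {f : ℝ → ℝ}

lemma kappa_eq (J : Set ℝ) :
    kappa J = (sInf J + ·) ∘ ((sSup J - sInf J) * ·) := by
  ext s
  rw [kappa, mul_comm, Function.comp_apply]

namespace IsBddInterval

lemma measurableEmbedding_kappa (hJ : IsBddInterval J) : MeasurableEmbedding (kappa J) := by
  rw [kappa_eq]
  exact (measurableEmbedding_addLeft _).comp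
    (measurableEmbedding_mulLeft₀ (sub_pos.2 hJ.sInf_lt_sSup).ne')

lemma map_kappa_volume (hJ : IsBddInterval J) :
    (volume.restrict (kappa J ⁻¹' J)).map (kappa J) =
      ENNReal.ofReal (sSup J - sInf J)⁻¹ • volume.restrict J := by
  have hL := sub_pos.2 hJ.sInf_lt_sSup
  rw [← hJ.measurableEmbedding_kappa.restrict_map, kappa_eq, ← Measure.map_map (by fun_prop)
    (by fun_prop), Real.map_volume_mul_left hL.ne', Measure.map_smul, map_add_left_eq_self,
    Measure.restrict_smul, abs_of_pos (inv_pos.2 hL)]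

lemma preimage_kappa (hJ : IsBddInterval J) :
    IsBddInterval (kappa J ⁻¹' J) ∧ sInf (kappa J ⁻¹' J) = 0 ∧ sSup (kappa J ⁻¹' J) = 1 := by
  have hL := sub_pos.2 hJ.sInf_lt_sSup
  refine isBddInterval_of_Ioo_subset one_pos ?_ (fun s hs => hJ.Ioo_subset ?_) fun s hs => ?_
  · refine hJ.1.preimage_mono fun s t hst => ?_
    unfold kappa
    gcongr
  · constructor <;> unfold kappa <;> nlinarith [hs.1, hs.2]
  · obtain ⟨hlower, hupper⟩ := hJ.subset_Icc hs
    unfold kappa at hlower hupper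
    exact ⟨nonneg_of_mul_nonneg_left (by linarith) hL,
      le_of_mul_le_mul_right (by linarith) hL⟩

lemma volume_preimage_kappa (hJ : IsBddInterval J) : volume (kappa J ⁻¹' J) = 1 := by
  obtain ⟨h, hInf, hSup⟩ := hJ.preimage_kappa
  rw [measure_congr h.ae_eq_Ioc, hInf, hSup]
  simp

lemma integralGini_comp_kappa (hJ : IsBddInterval J) (p q : ℝ) (f : ℝ → ℝ) :
    integralGini p q (kappa J ⁻¹' J) (f ∘ kappa J) = integralGini p q J f := by
  have hL := inv_pos.2 (sub_pos.2 hJ.sInf_lt_sSup)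
  rw [integralGini_eq_giniMean, ← giniMean_map hJ.measurableEmbedding_kappa, hJ.map_kappa_volume,
    giniMean_smul_measure (ENNReal.ofReal_pos.2 hL).ne' ENNReal.ofReal_ne_top,
    integralGini_eq_giniMean]

end IsBddInterval

lemma InLC.comp_kappa (h : InLC J f) : InLC (kappa J ⁻¹' J) (f ∘ kappa J) := by
  obtain ⟨hJ, a, b, ha, hf, hmaps⟩ := h
  refine ⟨hJ.preimage_kappa.1, a, b, ha, ?_, fun s hs => hmaps hs⟩
  rw [IntegrableOn, ← hJ.measurableEmbedding_kappa.integrable_map_iff, hJ.map_kappa_volume]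
  exact hf.smul_measure ENNReal.ofReal_ne_top

end Transport

/-! ### Lower and upper means -/

section Approximation

variable {J : Set ℝ} {p q : ℝ} {f : ℝ → ℝ}

/-- The index of the cell that contains `x`, in the partition of `[m, m + (k + 1) δ]` into `k + 1`
cells of length `δ`; the minimum puts the right end point into the last cell. -/
noncomputable def cellIndex (m δ : ℝ) (k : ℕ) (x : ℝ) : ℕ := min ⌊(x - m) / δ⌋₊ k

lemma isSimpleOn_cellIndex {k : ℕ} {δ : ℝ} (hδ : 0 < δ) (hJ : sSup J = sInf J + (k + 1) * δ)
    (h : ℕ → ℝ) :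
    IsSimpleOn J (fun x => h (cellIndex (sInf J) δ k x)) (k + 1) (fun i => sInf J + i * δ)
      (fun i => h i) := by
  refine ⟨fun i j hij => ?_, by simp, by simp [hJ], fun i x _ hlower hupper => ?_⟩
  · have hij' : ((i : ℕ) : ℝ) < (j : ℕ) := by exact_mod_cast hij
    simp only
    gcongr
  · simp only [Fin.val_castSucc, Fin.val_succ, Nat.cast_add, Nat.cast_one] at hlower hupper
    have hi : ((i : ℕ) : ℝ) ≤ (x - sInf J) / δ := (le_div_iff₀ hδ).2 (by linarith)
    suffices hcell : cellIndex (sInf J) δ k x = i from congrArg h hcell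
    rcases hupper with hupper | ⟨hlast, -⟩
    · have hi' : (x - sInf J) / δ < (i : ℕ) + 1 := (div_lt_iff₀ hδ).2 (by linarith)
      rw [cellIndex, (Nat.floor_eq_iff ((Nat.cast_nonneg _).trans hi)).2 ⟨hi, hi'⟩]
      exact min_eq_left (Nat.lt_succ_iff.1 i.2)
    · have hik : (i : ℕ) = k := by simpa using congrArg Fin.val hlast
      rw [hik] at hi ⊢
      exact min_eq_right (Nat.le_floor hi)

lemma abs_sub_cellIndex_le {m δ x : ℝ} {k : ℕ} (hδ : 0 < δ)
    (hx : x ∈ Icc m (m + (k + 1) * δ)) : |x - (m + cellIndex m δ k x * δ)| ≤ δ := by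
  have hlower : (cellIndex m δ k x : ℝ) ≤ (x - m) / δ :=
    (Nat.cast_le.2 (min_le_left _ _)).trans (Nat.floor_le (div_nonneg (sub_nonneg.2 hx.1) hδ.le))
  have hupper : (x - m) / δ ≤ cellIndex m δ k x + 1 := by
    unfold cellIndex
    rcases min_choice ⌊(x - m) / δ⌋₊ k with h | h <;> rw [h]
    · exact (Nat.lt_floor_add_one _).le
    · exact (div_le_iff₀ hδ).2 (by linarith [hx.2])
  rw [le_div_iff₀ hδ] at hlower
  rw [div_le_iff₀ hδ] at hupper
  exact abs_le.2 ⟨by linarith, by linarith⟩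

lemma exists_isSimpleOn_abs_sub_lt (hJ : IsBddInterval J) (hf : UniformContinuous f) {ε : ℝ}
    (hε : 0 < ε) :
    ∃ (g : ℝ → ℝ) (n : ℕ) (c : Fin (n + 1) → ℝ) (v : Fin n → ℝ), IsSimpleOn J g n c v ∧
      (∀ x, g x ∈ range f) ∧ ∀ x ∈ J, |f x - g x| < ε := by
  obtain ⟨η, hη, hfη⟩ := Metric.uniformContinuous_iff.1 hf ε hε
  have hL := sub_pos.2 hJ.sInf_lt_sSup
  obtain ⟨k, hk⟩ := exists_nat_gt ((sSup J - sInf J) / η)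
  set δ := (sSup J - sInf J) / (k + 1) with hδ_def
  have hδ : 0 < δ := by positivity
  have hδη : δ < η := by
    rw [div_lt_iff₀ hη] at hk
    exact (div_lt_iff₀ (by positivity)).2 (by linarith)
  have hsup : sSup J = sInf J + (k + 1) * δ := by
    rw [hδ_def, mul_div_cancel₀ _ (by positivity)]
    ring
  refine ⟨_, _, _, _, isSimpleOn_cellIndex hδ hsup fun i => f (sInf J + i * δ),
    fun x => mem_range_self _, fun x hx => hfη ?_⟩
  exact (abs_sub_cellIndex_le hδ (hsup ▸ hJ.subset_Icc hx)).trans_lt hδη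

lemma exists_uniformContinuous_lintegral_sub_le {α β : ℝ} (hαβ : α ≤ β) (hJ : MeasurableSet J)
    (hf : IntegrableOn f J) (hmaps : MapsTo f J (Icc α β)) {ε : ℝ≥0∞} (hε : ε ≠ 0) :
    ∃ h : ℝ → ℝ, UniformContinuous h ∧ (∀ x, h x ∈ Icc α β) ∧
      ∫⁻ x in J, ‖f x - h x‖ₑ ≤ ε := by
  obtain ⟨φ, hφs, hφ, hφc, -⟩ :=
    ((integrable_indicator_iff hJ).2 hf).exists_hasCompactSupport_lintegral_sub_le hε
  refine ⟨fun x => projIcc α β hαβ (φ x),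
    uniformContinuous_subtype_val.comp ((LipschitzWith.projIcc hαβ).uniformContinuous.comp
      (hφs.uniformContinuous_of_continuous hφc)), fun x => (projIcc α β hαβ _).2, ?_⟩
  refine (setLIntegral_mono' hJ fun x hx => ?_).trans ((setLIntegral_le_lintegral J _).trans hφ)
  rw [indicator_of_mem hx, enorm_le_iff_norm_le]
  simpa [projIcc_of_mem hαβ (hmaps hx)] using abs_projIcc_sub_projIcc hαβ (c := f x) (d := φ x)

lemma exists_isSimpleOn_lintegral_sub_lt (hJ : IsBddInterval J) (hf : IntegrableOn f J) {α β : ℝ}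
    (hmaps : MapsTo f J (Icc α β)) {ε : ℝ} (hε : 0 < ε) :
    ∃ (g : ℝ → ℝ) (n : ℕ) (c : Fin (n + 1) → ℝ) (v : Fin n → ℝ), IsSimpleOn J g n c v ∧
      (∀ x, g x ∈ Icc α β) ∧ ∫⁻ x in J, ‖f x - g x‖ₑ < ENNReal.ofReal ε := by
  have hL := sub_pos.2 hJ.sInf_lt_sSup
  have hvol : volume J = ENNReal.ofReal (sSup J - sInf J) := by
    rw [measure_congr hJ.ae_eq_Ioc, Real.volume_Ioc]
  obtain ⟨t, ht⟩ := hJ.nonempty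
  obtain ⟨h, hh, hhmaps, hfh⟩ := exists_uniformContinuous_lintegral_sub_le
    ((hmaps ht).1.trans (hmaps ht).2) hJ.measurableSet hf hmaps
    (ε := ENNReal.ofReal (ε / 4)) (ENNReal.ofReal_pos.2 (by positivity)).ne'
  obtain ⟨g, n, c, v, hg, hgh, hhg⟩ := exists_isSimpleOn_abs_sub_lt hJ hh
    (ε := ε / (4 * (sSup J - sInf J))) (by positivity)
  refine ⟨g, n, c, v, hg, fun x => ?_, ?_⟩
  · obtain ⟨y, hy⟩ := hgh x
    exact hy ▸ hhmaps y
  have hpt : ∀ x ∈ J, ‖f x - g x‖ₑ ≤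
      ‖f x - h x‖ₑ + ENNReal.ofReal (ε / (4 * (sSup J - sInf J))) := fun x hx => by
    rw [← sub_add_sub_cancel _ (h x)]
    refine (enorm_add_le _ _).trans (add_le_add_right ?_ _)
    rw [← ofReal_norm]
    exact ENNReal.ofReal_le_ofReal (hhg x hx).le
  calc ∫⁻ x in J, ‖f x - g x‖ₑ
    _ ≤ (∫⁻ x in J, ‖f x - h x‖ₑ) +
        ENNReal.ofReal (ε / (4 * (sSup J - sInf J))) * volume J := by
        refine (setLIntegral_mono' hJ.measurableSet hpt).trans_eq ?_
        rw [lintegral_add_right _ measurable_const, setLIntegral_const]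
    _ ≤ ENNReal.ofReal (ε / 4 + ε / 4) := by
        rw [hvol, ← ENNReal.ofReal_mul (by positivity), ENNReal.ofReal_add (by positivity)
          (by positivity), show ε / (4 * (sSup J - sInf J)) * (sSup J - sInf J) = ε / 4 by
            field_simp]
        gcongr
    _ < ENNReal.ofReal ε := (ENNReal.ofReal_lt_ofReal_iff hε).2 (by linarith)

lemma RG_subset_Icc {α β : ℝ} (h : MapsTo f J (Icc α β)) : RG J f ⊆ Icc α β :=
  closure_minimal (convexHull_min (mapsTo_iff_image_subset.1 h) (convex_Icc α β)) isClosed_Icc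

lemma ordConnected_RG : (RG J f).OrdConnected :=
  ((convex_convexHull ℝ _).closure).ordConnected

lemma mem_RG {x : ℝ} (hx : x ∈ J) : f x ∈ RG J f :=
  subset_closure (subset_convexHull ℝ _ (mem_image_of_mem f hx))

lemma RG_eq_Icc (hJ : J.Nonempty) (hbelow : BddBelow (f '' J)) (habove : BddAbove (f '' J)) :
    RG J f = Icc (sInf (f '' J)) (sSup (f '' J)) := by
  have hne := hJ.image f
  refine (RG_subset_Icc fun x hx => ?_).antisymm fun y hy => ?_
  · exact ⟨csInf_le hbelow (mem_image_of_mem f hx), le_csSup habove (mem_image_of_mem f hx)⟩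
  · exact mem_closure_convexHull hne (fun u hu => (le_csInf hne hu).trans hy.1)
      fun u hu => hy.2.trans (csSup_le hne hu)

lemma InLC.approxValues_nonempty (h : InLC J f) (M : WeightedOp) {ε : ℝ} (hε : 0 < ε) :
    (approxValues (Ioi 0) M J f ε).Nonempty := by
  obtain ⟨hJ, a, b, ha, hf, hmaps⟩ := h
  have hRG := RG_eq_Icc hJ.nonempty (f := f) ⟨a, forall_mem_image.2 fun x hx => (hmaps hx).1⟩
    ⟨b, forall_mem_image.2 fun x hx => (hmaps hx).2⟩
  obtain ⟨g, n, c, v, hg, hgm, hfg⟩ :=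
    exists_isSimpleOn_lintegral_sub_lt hJ hf (fun x hx => hRG ▸ mem_RG hx) hε
  rw [← hRG] at hgm
  refine ⟨_, g, n, c, v, hg, fun x _ => ha.trans_le (RG_subset_Icc hmaps (hgm x)).1, ?_, hfg, rfl⟩
  have hsub : RG J g ⊆ RG J f := by
    rw [hRG] at hgm ⊢
    exact RG_subset_Icc fun x _ => hgm x
  rw [sdiff_eq_empty.2 hsub, measure_empty]
  exact ENNReal.ofReal_pos.2 hε

lemma approxValues_mono (I : Set ℝ) (M : WeightedOp) (J : Set ℝ) (f : ℝ → ℝ) :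
    Monotone (approxValues I M J f) := by
  rintro ε δ hεδ y ⟨g, n, c, v, hg, hmaps, hRG, hfg, hy⟩
  have hεδ' := ENNReal.ofReal_le_ofReal hεδ
  exact ⟨g, n, c, v, hg, hmaps, hRG.trans_le hεδ', hfg.trans_le hεδ', hy⟩

lemma mapsTo_Icc_of_close (hJ : MeasurableSet J) (hvol : volume J = 1) {g : ℝ → ℝ} {a b ε : ℝ}
    (hf : MapsTo f J (Icc a b)) (hRG : volume (RG J g \ RG J f) < ENNReal.ofReal ε)
    (hfg : ∫⁻ x in J, ‖f x - g x‖ₑ < ENNReal.ofReal ε) :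
    MapsTo g J (Icc (a - 2 * ε) (b + 2 * ε)) := by
  have hε : 0 < ε := ENNReal.ofReal_pos.1 hRG.pos
  obtain ⟨x, hx, hxε⟩ : ∃ x ∈ J, |f x - g x| < ε := by
    by_contra! h
    have hle : ∫⁻ _ in J, ENNReal.ofReal ε ≤ ∫⁻ x in J, ‖f x - g x‖ₑ :=
      setLIntegral_mono' hJ fun x hx => by
        rw [← ofReal_norm]
        exact ENNReal.ofReal_le_ofReal (h x hx)
    rw [setLIntegral_const, hvol, mul_one] at hle
    exact hfg.not_ge hle
  have gap {c d : ℝ} (hc : c ∈ RG J g) (hd : d ∈ RG J g) (hcd : Disjoint (Icc c d) (RG J f)) :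
      d - c < ε := by
    have hlt := (measure_mono (subset_sdiff.2 ⟨ordConnected_RG.out hc hd, hcd⟩)).trans_lt hRG
    rw [Real.volume_Icc] at hlt
    exact (ENNReal.ofReal_lt_ofReal_iff hε).1 hlt
  obtain ⟨hxlower, hxupper⟩ := abs_lt.1 hxε
  obtain ⟨hax, hxb⟩ := hf hx
  intro y hy
  by_contra hy'
  rw [mem_Icc, not_and_or, not_le, not_le] at hy'
  rcases hy' with hya | hyb
  · have hmem : a - ε ∈ RG J g :=
      ordConnected_RG.out (mem_RG hy) (mem_RG hx) ⟨by linarith, by linarith⟩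
    refine (gap (mem_RG hy) hmem (disjoint_left.2 fun z hz hzf => ?_)).not_ge (by linarith)
    linarith [hz.2, (RG_subset_Icc hf hzf).1]
  · have hmem : b + ε ∈ RG J g :=
      ordConnected_RG.out (mem_RG hx) (mem_RG hy) ⟨by linarith, by linarith⟩
    refine (gap hmem (mem_RG hy) (disjoint_left.2 fun z hz hzf => ?_)).not_ge (by linarith)
    linarith [hz.1, (RG_subset_Icc hf hzf).2]

lemma tendsto_lintegral_comp_sub (hJ : MeasurableSet J) {φ : ℝ → ℝ}
    (hφ : ContDiffOn ℝ 1 φ (Ioi 0)) {a b : ℝ} (ha : 0 < a) {F : ℕ → ℝ → ℝ}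
    (hF : ∀ n, MapsTo (F n) J (Icc a b)) (hf : MapsTo f J (Icc a b))
    (h : Tendsto (fun n => ∫⁻ t in J, ‖F n t - f t‖ₑ) atTop (𝓝 0)) :
    Tendsto (fun n => ∫⁻ t in J, ‖φ (F n t) - φ (f t)‖ₑ) atTop (𝓝 0) := by
  obtain ⟨K, hK⟩ := (hφ.mono fun x (hx : x ∈ Icc a b) => ha.trans_le hx.1).exists_lipschitzOnWith
    one_ne_zero (convex_Icc a b) isCompact_Icc
  have hlim : Tendsto (fun n => (K : ℝ≥0∞) * ∫⁻ t in J, ‖F n t - f t‖ₑ) atTop (𝓝 0) := by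
    simpa using ENNReal.Tendsto.const_mul h (Or.inr (ENNReal.coe_ne_top (r := K)))
  refine tendsto_of_tendsto_of_tendsto_of_le_of_le tendsto_const_nhds hlim (fun _ => zero_le)
    fun n => ?_
  simp only [← lintegral_const_mul' _ _ (ENNReal.coe_ne_top (r := K)), ← edist_eq_enorm_sub]
  exact setLIntegral_mono' hJ fun t ht => hK (hF n ht) (hf ht)

lemma giniTendsto_of_mapsTo_Icc (p q : ℝ) (hJ : MeasurableSet J) {a b : ℝ} (ha : 0 < a)
    {F : ℕ → ℝ → ℝ} (hF : ∀ n, MapsTo (F n) J (Icc a b)) (hf : MapsTo f J (Icc a b))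
    (h : Tendsto (fun n => ∫⁻ t in J, ‖F n t - f t‖ₑ) atTop (𝓝 0)) : GiniTendsto p q J F f :=
  ⟨h, tendsto_lintegral_comp_sub hJ (contDiffOn_rpow p) ha hF hf h,
    fun _ => tendsto_lintegral_comp_sub hJ (contDiffOn_rpow q) ha hF hf h,
    fun _ => tendsto_lintegral_comp_sub hJ (contDiffOn_rpow_mul_log p) ha hF hf h⟩

lemma InLC.exists_approxValues_subset_ball (h : InLC J f) (hvol : volume J = 1) (p q : ℝ) {δ : ℝ}
    (hδ : 0 < δ) :
    ∃ ε > 0, approxValues (Ioi 0) (gini p q) J f ε ⊆ Metric.ball (integralGini p q J f) δ := by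
  obtain ⟨hJ, a, b, ha, -, hmaps⟩ := id h
  obtain ⟨ε, -, hεpos, hε⟩ := exists_seq_strictAnti_tendsto' (show (0 : ℝ) < a / 4 by positivity)
  by_contra! hcon
  choose y hy hyδ using fun n => not_subset.1 (hcon (ε n) (hεpos n).1)
  choose g k c v hg hpos hRG hfg hval using hy
  have hgm (n : ℕ) : MapsTo (g n) J (Icc (a / 2) (b + a / 2)) :=
    (mapsTo_Icc_of_close hJ.measurableSet hvol hmaps (hRG n) (hfg n)).mono_right
      (Icc_subset_Icc (by linarith [(hεpos n).2]) (by linarith [(hεpos n).2]))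
  have hlim : Tendsto (fun n => ∫⁻ t in J, ‖g n t - f t‖ₑ) atTop (𝓝 0) := by
    refine tendsto_of_tendsto_of_tendsto_of_le_of_le tendsto_const_nhds
      (ENNReal.ofReal_zero ▸ ENNReal.tendsto_ofReal hε) (fun _ => zero_le) fun n => ?_
    simp_rw [enorm_sub_rev (g n _)]
    exact (hfg n).le
  have hlimGini := tendsto_integralGini (fun n => (hg n).giniDom p q hJ (hpos n)) (h.giniDom p q)
    (giniTendsto_of_mapsTo_Icc p q hJ.measurableSet (half_pos ha) hgm
      (hmaps.mono_right (Icc_subset_Icc (by linarith) (by linarith))) hlim)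
  obtain ⟨n, hn⟩ := (hlimGini.eventually (Metric.ball_mem_nhds _ hδ)).exists
  refine hyδ n ?_
  rwa [hval, ← (hg n).integralGini_eq p q hJ]

/-- The filter generated by the sets of values of `M` at the simple functions `ε`-close to `f`: the
lower and the upper mean are the lower and the upper limit along this filter. -/
noncomputable def approxFilter (I : Set ℝ) (M : WeightedOp) (J : Set ℝ) (f : ℝ → ℝ) : Filter ℝ :=
  ⨅ (ε : ℝ) (_ : 0 < ε), 𝓟 (approxValues I M J f ε)

lemma hasBasis_approxFilter (I : Set ℝ) (M : WeightedOp) (J : Set ℝ) (f : ℝ → ℝ) :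
    (approxFilter I M J f).HasBasis (0 < ·) (approxValues I M J f) :=
  hasBasis_biInf_principal'
    (fun ε hε δ hδ => ⟨min ε δ, lt_min hε hδ,
      approxValues_mono I M J f (min_le_left _ _), approxValues_mono I M J f (min_le_right _ _)⟩)
    ⟨1, one_pos⟩

theorem InLC.lowerMean_eq_and_upperMean_eq (h : InLC J f) (p q : ℝ) :
    lowerMean (Ioi 0) (gini p q) J f = (integralGini p q J f : EReal) ∧
      upperMean (Ioi 0) (gini p q) J f = (integralGini p q J f : EReal) := by
  have hbasis := hasBasis_approxFilter (Ioi 0) (gini p q) (kappa J ⁻¹' J) (f ∘ kappa J)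
  have hne : (approxFilter (Ioi 0) (gini p q) (kappa J ⁻¹' J) (f ∘ kappa J)).NeBot :=
    hbasis.neBot_iff.2 fun hε => h.comp_kappa.approxValues_nonempty _ hε
  have hlim : approxFilter (Ioi 0) (gini p q) (kappa J ⁻¹' J) (f ∘ kappa J) ≤
      𝓝 (integralGini p q J f) := by
    rw [← h.1.integralGini_comp_kappa, (hbasis.le_basis_iff Metric.nhds_basis_ball)]
    exact fun δ hδ => h.comp_kappa.exists_approxValues_subset_ball h.1.volume_preimage_kappa p q hδ
  have hlimEReal := (continuous_coe_real_ereal.tendsto _).mono_left hlim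
  exact ⟨hbasis.liminf_eq_iSup_iInf.symm.trans hlimEReal.liminf_eq,
    hbasis.limsup_eq_iInf_iSup.symm.trans hlimEReal.limsup_eq⟩

theorem isContinuousExtension_iff (p q : ℝ) (N : Set ℝ → (ℝ → ℝ) → ℝ) :
    IsContinuousExtension p q N ↔ ∀ J f, giniDom p q J f → N J f = integralGini p q J f := by
  constructor
  · rintro ⟨hmeans, hcont⟩ J f hf
    have hF (n : ℕ) := (hf.inLC_truncate n).giniDom p q
    refine tendsto_nhds_unique (hcont J _ f hF hf hf.giniTendsto_truncate)
      ((tendsto_integralGini hF hf hf.giniTendsto_truncate).congr fun n => EReal.coe_injective ?_)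
    have hn := hf.inLC_truncate n
    exact (hn.lowerMean_eq_and_upperMean_eq p q).1.symm.trans (hmeans J _ hn).1
  · intro h
    refine ⟨fun J f hf => ?_, fun J F f hF hf hFf => ?_⟩
    · rw [h J f (hf.giniDom p q)]
      exact hf.lowerMean_eq_and_upperMean_eq p q
    · simp_rw [h J f hf, h J _ (hF _)]
      exact tendsto_integralGini hF hf hFf

end Approximation

/-! ### Hardy inequalities -/

section HardyConst

variable {α : Type*} [MeasurableSpace α] {μ : Measure α} {f : α → ℝ} {p q r a b y z : ℝ}

/-- The best constant in both Hardy inequalities when `q ≤ 0 ≤ p < 1`; the value at `p = q` is only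
meaningful for `p = q = 0`. -/
noncomputable def hardyConst (p q : ℝ) : ℝ :=
  if p = q then Real.exp 1 else ((1 - q) / (1 - p)) ^ (1 / (p - q))

lemma hardyConst_self (p : ℝ) : hardyConst p p = Real.exp 1 := if_pos rfl

lemma hardyConst_of_ne (hpq : p ≠ q) :
    hardyConst p q = ((1 - q) / (1 - p)) ^ (1 / (p - q)) := if_neg hpq

lemma hardyConst_pos (hp : p < 1) (hq : q < 1) : 0 < hardyConst p q := by
  unfold hardyConst
  split_ifs
  · exact Real.exp_pos 1
  · exact Real.rpow_pos_of_pos (div_pos (sub_pos.2 hq) (sub_pos.2 hp)) _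

lemma hardyConst_comm (hp : p < 1) (hq : q < 1) : hardyConst p q = hardyConst q p := by
  rcases eq_or_ne p q with rfl | hpq
  · rfl
  · rw [hardyConst_of_ne hpq, hardyConst_of_ne hpq.symm, ← inv_div (1 - q), Real.inv_rpow
      (div_pos (sub_pos.2 hq) (sub_pos.2 hp)).le, ← Real.rpow_neg
      (div_pos (sub_pos.2 hq) (sub_pos.2 hp)).le]
    congr 1
    rw [← one_div_neg_eq_neg_one_div, neg_sub]

lemma hardyConst_zero_rpow (hr : r < 1) : hardyConst r 0 ^ r = (1 - r)⁻¹ := by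
  rcases eq_or_ne r 0 with rfl | hr0
  · simp
  · rw [hardyConst_of_ne hr0, sub_zero, sub_zero, one_div, one_div,
      Real.rpow_inv_rpow (inv_nonneg.2 (sub_nonneg.2 hr.le)) hr0]

lemma hardyConst_eq_mul (hp : p < 1) (hq : q < 1) (hpq : p ≠ q) :
    hardyConst p q = hardyConst p 0 ^ (p / (p - q)) * hardyConst q 0 ^ (-q / (p - q)) := by
  have hCp := (hardyConst_pos hp one_pos).le
  have hCq := (hardyConst_pos hq one_pos).le
  rw [hardyConst_of_ne hpq, ← mul_one_div p, ← mul_one_div (-q), Real.rpow_mul hCp,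
    Real.rpow_mul hCq, Real.rpow_neg hCq, hardyConst_zero_rpow hp, hardyConst_zero_rpow hq,
    inv_inv, ← Real.mul_rpow (inv_nonneg.2 (sub_pos.2 hp).le) (sub_pos.2 hq).le, inv_mul_eq_div]

lemma boxCox_div_hardyConst (hr : r < 1) (hz : 0 < z) :
    boxCox r (z / hardyConst r 0) = (1 - r) * boxCox r z - 1 := by
  have hC := hardyConst_pos hr one_pos
  rcases eq_or_ne r 0 with rfl | hr0
  · rw [boxCox_zero, boxCox_zero, Real.log_div hz.ne' hC.ne', hardyConst_self, Real.log_exp,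
      sub_zero, one_mul]
  · rw [boxCox_of_ne hr0, boxCox_of_ne hr0, Real.div_rpow hz.le hC.le, hardyConst_zero_rpow hr,
      div_inv_eq_mul]
    field_simp
    ring

namespace GiniIntegrable

lemma integral_boxCox_div (h : GiniIntegrable r 0 μ f) (hy : 0 < y) :
    ∫ x, boxCox r (f x / y) ∂μ = μ.real univ * boxCox r (giniMean r 0 μ f / y) := by
  simpa using h.integral_rpow_mul_boxCox_div hy

lemma giniMean_zero_le_iff (h : GiniIntegrable r 0 μ f) (hy : 0 < y) :
    giniMean r 0 μ f ≤ y ↔ ∫ x, boxCox r (f x / y) ∂μ ≤ 0 := by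
  simpa using h.giniMean_le_iff hy

/-- Since the weights `p / (p - q)` and `-q / (p - q)` add up to `1`, this reduces Hardy
inequalities for the parameters `p, q` to those for the power means, that is, for `p, 0` and
`q, 0`. -/
lemma giniMean_le_hardyConst_mul (h : GiniIntegrable p q μ f) (hp : GiniIntegrable p 0 μ f)
    (hq : GiniIntegrable q 0 μ f) (hpq : p ≠ q) (hp0 : 0 ≤ p) (hp1 : p < 1) (hq0 : q ≤ 0)
    (hpa : giniMean p 0 μ f ≤ hardyConst p 0 * a) (hqb : giniMean q 0 μ f ≤ hardyConst q 0 * b) :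
    giniMean p q μ f ≤ hardyConst p q * (p / (p - q) * a + -q / (p - q) * b) := by
  have hq1 : q < 1 := hq0.trans_lt one_pos
  have hCp := hardyConst_pos hp1 one_pos
  have hCq := hardyConst_pos hq1 one_pos
  have ha : 0 ≤ a := (pos_of_mul_pos_right (hp.giniMean_pos.trans_le hpa) hCp.le).le
  have hb : 0 ≤ b := (pos_of_mul_pos_right (hq.giniMean_pos.trans_le hqb) hCq.le).le
  have hsub : 0 < p - q := sub_pos.2 ((hq0.trans hp0).lt_of_ne' hpq)
  have hθ : 0 ≤ p / (p - q) := by positivity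
  have hθ' : 0 ≤ -q / (p - q) := div_nonneg (neg_nonneg.2 hq0) hsub.le
  have hsum : p / (p - q) + -q / (p - q) = 1 := by field_simp; ring
  calc giniMean p q μ f
      = giniMean p 0 μ f ^ (p / (p - q)) * giniMean q 0 μ f ^ (-q / (p - q)) :=
        h.giniMean_eq_mul hp hq hpq
    _ ≤ (hardyConst p 0 * a) ^ (p / (p - q)) * (hardyConst q 0 * b) ^ (-q / (p - q)) := by
        gcongr
        exacts [Real.rpow_nonneg hq.giniMean_pos.le _, hp.giniMean_pos.le, hq.giniMean_pos.le]
    _ = hardyConst p q * (a ^ (p / (p - q)) * b ^ (-q / (p - q))) := by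
        rw [hardyConst_eq_mul hp1 hq1 hpq, Real.mul_rpow hCp.le ha, Real.mul_rpow hCq.le hb]
        ring
    _ ≤ hardyConst p q * (p / (p - q) * a + -q / (p - q) * b) := by
        gcongr
        · exact (hardyConst_pos hp1 hq1).le
        · exact Real.geom_mean_le_arith_mean2_weighted hθ hθ' ha hb hsum

end GiniIntegrable

end HardyConst

section DiscreteUpper

variable {p q r : ℝ} {x w : ℕ → ℝ}

/-- The measure on `ℕ` with mass `w i` at each `i < n`. -/
noncomputable def weightMeasure (w : ℕ → ℝ) (n : ℕ) : Measure ℕ :=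
  ∑ i ∈ Finset.range n, ENNReal.ofReal (w i) • Measure.dirac i

lemma integrable_weightMeasure (w f : ℕ → ℝ) (n : ℕ) : Integrable f (weightMeasure w n) :=
  integrable_finsetSum_measure.2 fun _ _ =>
    (integrable_dirac enorm_lt_top).smul_measure ENNReal.ofReal_ne_top

lemma integral_weightMeasure (hw : ∀ n, 0 < w n) (f : ℕ → ℝ) (n : ℕ) :
    ∫ i, f i ∂weightMeasure w n = ∑ i ∈ Finset.range n, w i * f i := by
  rw [weightMeasure, integral_finsetSum_measure fun _ _ =>
    (integrable_dirac enorm_lt_top).smul_measure ENNReal.ofReal_ne_top]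
  simp only [integral_smul_measure, integral_dirac, ENNReal.toReal_ofReal (hw _).le, smul_eq_mul]

lemma real_univ_weightMeasure (hw : ∀ n, 0 < w n) (n : ℕ) :
    (weightMeasure w n).real univ = ∑ i ∈ Finset.range n, w i := by
  simpa using integral_weightMeasure hw (fun _ => 1) n

lemma gini_eq_giniMean (hw : ∀ n, 0 < w n) (p q : ℝ) (x : ℕ → ℝ) (n : ℕ) :
    gini p q n (fun i : Fin n => x i) (fun i : Fin n => w i) =
      giniMean p q (weightMeasure w n) x := by
  simp only [gini, giniMean, integral_weightMeasure hw, Finset.sum_range]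

lemma giniIntegrable_weightMeasure (p q : ℝ) (hx : ∀ n, 0 < x n) (hw : ∀ n, 0 < w n) (n : ℕ) :
    GiniIntegrable p q (weightMeasure w (n + 1)) x where
  ne_zero := fun h => by
    have mass := real_univ_weightMeasure hw (n + 1)
    rw [h, measureReal_zero_apply] at mass
    exact (Finset.sum_pos (fun i _ => hw i) Finset.nonempty_range_add_one).ne mass
  pos := .of_forall hx
  left := integrable_weightMeasure _ _ _
  right := integrable_weightMeasure _ _ _
  log := fun _ => integrable_weightMeasure _ _ _

lemma sum_boxCox_div_le (hr : r ≤ 1) (hx : ∀ n, 0 < x n) (hw : ∀ n, 0 < w n) (n : ℕ) {y : ℝ}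
    (hy : 0 < y) :
    ∑ i ∈ Finset.range n, w i * boxCox r (x i / y) ≤
      (∑ i ∈ Finset.range n, w i) * (giniMean r 0 (weightMeasure w n) x / y - 1) := by
  cases n with
  | zero => simp
  | succ n =>
    have h := giniIntegrable_weightMeasure r 0 hx hw n
    rw [← integral_weightMeasure hw fun i => boxCox r (x i / y), h.integral_boxCox_div hy,
      real_univ_weightMeasure hw]
    gcongr
    · exact Finset.sum_nonneg fun i _ => (hw i).le
    · exact boxCox_le_sub_one hr (div_pos h.giniMean_pos hy)

/-- The inequality is telescoping: up to the factor `1 - r` it says that `w n * M (n + 1)` is at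
most `hardyConst r 0 * (w n * x n)` plus the difference of consecutive terms of
`(∑ i < n, w i) * M n`. -/
lemma giniMean_zero_succ_le (hr : r < 1) (hx : ∀ n, 0 < x n) (hw : ∀ n, 0 < w n) (n : ℕ) :
    (∑ i ∈ Finset.range (n + 1), w i + (1 - r) * w n) * giniMean r 0 (weightMeasure w (n + 1)) x ≤
      (∑ i ∈ Finset.range n, w i) * giniMean r 0 (weightMeasure w n) x +
        (1 - r) * w n * (hardyConst r 0 * x n) := by
  set Λ := ∑ i ∈ Finset.range n, w i with hΛ
  set m := giniMean r 0 (weightMeasure w n) x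
  have hk : 0 < 1 - r := sub_pos.2 hr
  have hC := hardyConst_pos hr one_pos
  have hwn := hw n
  have hxn := hx n
  have hΛ0 : 0 ≤ Λ := Finset.sum_nonneg fun i _ => (hw i).le
  have hm0 : 0 ≤ m := giniMean_nonneg (.of_forall fun i => (hx i).le)
  rw [Finset.sum_range_succ, ← hΛ, mul_comm, ← le_div_iff₀ (by positivity)]
  set y := (Λ * m + (1 - r) * w n * (hardyConst r 0 * x n)) / (Λ + w n + (1 - r) * w n) with hy_def
  have hy : 0 < y := by positivity
  have tangent_last : boxCox r (x n / y) ≤ (1 - r) * (hardyConst r 0 * x n / y - 1) - 1 := by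
    have hz : 0 < hardyConst r 0 * x n / y := by positivity
    have hsplit : x n / y = hardyConst r 0 * x n / y / hardyConst r 0 := by field_simp
    rw [hsplit, boxCox_div_hardyConst hr hz]
    gcongr
    exact boxCox_le_sub_one hr.le hz
  rw [(giniIntegrable_weightMeasure r 0 hx hw n).giniMean_zero_le_iff hy,
    integral_weightMeasure hw, Finset.sum_range_succ]
  calc _ ≤ Λ * (m / y - 1) + w n * ((1 - r) * (hardyConst r 0 * x n / y - 1) - 1) := by
        gcongr
        exact sum_boxCox_div_le hr.le hx hw n hy
    _ = (Λ * m + (1 - r) * w n * (hardyConst r 0 * x n)) / y - (Λ + w n + (1 - r) * w n) := by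
        field_simp
        ring
    _ = 0 := by
        rw [hy_def]
        field_simp
        ring

lemma sum_giniMean_zero_le (hr : r < 1) (hx : ∀ n, 0 < x n) (hw : ∀ n, 0 < w n) (N : ℕ) :
    ∑ n ∈ Finset.range N, w n * giniMean r 0 (weightMeasure w (n + 1)) x ≤
      hardyConst r 0 * ∑ n ∈ Finset.range N, w n * x n := by
  set m := fun n => giniMean r 0 (weightMeasure w n) x
  have telescoped : (1 - r) * ∑ n ∈ Finset.range N, w n * m (n + 1) +
      (∑ i ∈ Finset.range N, w i) * m N ≤
        (1 - r) * (hardyConst r 0 * ∑ n ∈ Finset.range N, w n * x n) := by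
    induction N with
    | zero => simp
    | succ N ih =>
      have step := giniMean_zero_succ_le hr hx hw N
      rw [Finset.sum_range_succ _ N, Finset.sum_range_succ (fun n => w n * x n) N]
      linarith
  have remainder_nonneg : 0 ≤ (∑ i ∈ Finset.range N, w i) * m N :=
    mul_nonneg (Finset.sum_nonneg fun i _ => (hw i).le)
      (giniMean_nonneg (.of_forall fun i => (hx i).le))
  exact le_of_mul_le_mul_left (by linarith) (sub_pos.2 hr)

lemma sum_giniMean_le (hq : q ≤ 0) (hp0 : 0 ≤ p) (hp : p < 1) (hx : ∀ n, 0 < x n)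
    (hw : ∀ n, 0 < w n) (N : ℕ) :
    ∑ n ∈ Finset.range N, w n * giniMean p q (weightMeasure w (n + 1)) x ≤
      hardyConst p q * ∑ n ∈ Finset.range N, w n * x n := by
  rcases eq_or_ne p q with rfl | hpq
  · obtain rfl := le_antisymm hq hp0
    exact sum_giniMean_zero_le hp hx hw N
  have hq1 : q < 1 := hq.trans_lt one_pos
  have hsub : 0 < p - q := sub_pos.2 ((hq.trans hp0).lt_of_ne' hpq)
  set X := ∑ n ∈ Finset.range N, w n * x n
  set scaledMean := fun r n =>
    giniMean r 0 (weightMeasure w (n + 1)) x / hardyConst r 0 with scaledMean_def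
  have sum_scaledMean_le (r : ℝ) (hr : r < 1) :
      ∑ n ∈ Finset.range N, w n * scaledMean r n ≤ X := by
    simp only [scaledMean_def, ← mul_div_assoc, ← Finset.sum_div]
    exact (div_le_iff₀' (hardyConst_pos hr one_pos)).2 (sum_giniMean_zero_le hr hx hw N)
  have mean_eq (r : ℝ) (hr : r < 1) (n : ℕ) :
      giniMean r 0 (weightMeasure w (n + 1)) x = hardyConst r 0 * scaledMean r n :=
    (mul_div_cancel₀ _ (hardyConst_pos hr one_pos).ne').symm
  have interpolation (n : ℕ) : giniMean p q (weightMeasure w (n + 1)) x ≤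
      hardyConst p q * (p / (p - q) * scaledMean p n + -q / (p - q) * scaledMean q n) :=
    (giniIntegrable_weightMeasure p q hx hw n).giniMean_le_hardyConst_mul
      (giniIntegrable_weightMeasure p 0 hx hw n) (giniIntegrable_weightMeasure q 0 hx hw n) hpq hp0
      hp hq (mean_eq p hp n).le (mean_eq q hq1 n).le
  calc _ ≤ ∑ n ∈ Finset.range N, w n *
        (hardyConst p q * (p / (p - q) * scaledMean p n + -q / (p - q) * scaledMean q n)) :=
        Finset.sum_le_sum fun n _ => mul_le_mul_of_nonneg_left (interpolation n) (hw n).le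
    _ = hardyConst p q * (p / (p - q) * ∑ n ∈ Finset.range N, w n * scaledMean p n +
        -q / (p - q) * ∑ n ∈ Finset.range N, w n * scaledMean q n) := by
        simp only [Finset.mul_sum, ← Finset.sum_add_distrib]
        exact Finset.sum_congr rfl fun n _ => by ring
    _ ≤ hardyConst p q * (p / (p - q) * X + -q / (p - q) * X) := by
        gcongr
        · exact (hardyConst_pos hp hq1).le
        · exact sum_scaledMean_le p hp
        · exact div_nonneg (neg_nonneg.2 hq) hsub.le
        · exact sum_scaledMean_le q hq1
    _ = hardyConst p q * X := by
        field_simp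
        ring

lemma tsum_ofReal_le_of_sum_range_le {a b : ℕ → ℝ} {C : ℝ} (hC : 0 ≤ C) (ha : ∀ n, 0 ≤ a n)
    (hb : ∀ n, 0 ≤ b n)
    (h : ∀ N, ∑ n ∈ Finset.range N, a n ≤ C * ∑ n ∈ Finset.range N, b n) :
    ∑' n, ENNReal.ofReal (a n) ≤ ENNReal.ofReal C * ∑' n, ENNReal.ofReal (b n) := by
  refine ENNReal.tsum_le_of_sum_range_le fun N => ?_
  rw [← ENNReal.ofReal_sum_of_nonneg fun i _ => ha i]
  calc _ ≤ ENNReal.ofReal (C * ∑ n ∈ Finset.range N, b n) := ENNReal.ofReal_le_ofReal (h N)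
    _ = ENNReal.ofReal C * ∑ n ∈ Finset.range N, ENNReal.ofReal (b n) := by
        rw [ENNReal.ofReal_mul hC, ENNReal.ofReal_sum_of_nonneg fun i _ => hb i]
    _ ≤ _ := by
        gcongr
        exact ENNReal.sum_le_tsum _

/-- The set of all constants in the discrete Hardy inequality for `M`, the least element of which is
the Hardy constant. -/
def hardyBounds (M : WeightedOp) : Set ℝ≥0∞ :=
  {H : ℝ≥0∞ | ∀ x w : ℕ → ℝ, (∀ n, 0 < x n ∧ x n ∈ Ioi (0 : ℝ)) → (∀ n, 0 < w n) →
    ∑' n : ℕ, ENNReal.ofReal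
        (w n * M (n + 1) (fun i : Fin (n + 1) => x i) (fun i : Fin (n + 1) => w i)) ≤
      H * ∑' n : ℕ, ENNReal.ofReal (w n * x n)}

lemma mem_hardyBounds_gini_iff {H : ℝ≥0∞} :
    H ∈ hardyBounds (gini p q) ↔ ∀ x w : ℕ → ℝ, (∀ n, 0 < x n) → (∀ n, 0 < w n) →
      ∑' n, ENNReal.ofReal (w n * giniMean p q (weightMeasure w (n + 1)) x) ≤
        H * ∑' n, ENNReal.ofReal (w n * x n) := by
  simp only [hardyBounds, mem_ofPred_eq, mem_Ioi, and_self]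
  exact forall₄_congr fun x w _ hw => by simp only [gini_eq_giniMean hw]

lemma hardyBounds_gini_comm (p q : ℝ) : hardyBounds (gini p q) = hardyBounds (gini q p) := by
  ext H
  simp only [mem_hardyBounds_gini_iff]
  exact forall₄_congr fun x w hx hw => by
    simp only [(giniIntegrable_weightMeasure p q hx hw _).giniMean_comm]

lemma ofReal_hardyConst_mem_hardyBounds_gini (hq : q ≤ 0) (hp0 : 0 ≤ p) (hp : p < 1) :
    ENNReal.ofReal (hardyConst p q) ∈ hardyBounds (gini p q) := by
  refine mem_hardyBounds_gini_iff.2 fun x w hx hw => ?_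
  exact tsum_ofReal_le_of_sum_range_le (hardyConst_pos hp (hq.trans_lt one_pos)).le
    (fun n => mul_nonneg (hw n).le (giniMean_nonneg (.of_forall fun i => (hx i).le)))
    (fun n => (mul_pos (hw n) (hx n)).le) (sum_giniMean_le hq hp0 hp hx hw)

end DiscreteUpper

section WeightedAverage

variable {r t : ℝ} {f : ℝ → ℝ}

lemma integrableOn_Ioo_rpow (hr : -1 < r) (ht : 0 < t) :
    IntegrableOn (fun s : ℝ => s ^ r) (Ioo 0 t) :=
  (intervalIntegral.integrableOn_Ioo_rpow_iff ht).2 hr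

lemma integral_Ioo_rpow (hr : -1 < r) (ht : 0 < t) :
    ∫ s in Ioo 0 t, s ^ r = t ^ (r + 1) / (r + 1) := by
  rw [← integral_Ioc_eq_integral_Ioo, ← intervalIntegral.integral_of_le ht.le,
    integral_rpow (.inl hr), Real.zero_rpow (by linarith), sub_zero]

lemma integrableOn_Ioo_log (ht : 0 < t) : IntegrableOn Real.log (Ioo 0 t) :=
  ((intervalIntegrable_iff_integrableOn_Ioc_of_le ht.le).1
    intervalIntegral.intervalIntegrable_log').mono_set Ioo_subset_Ioc_self

lemma integral_Ioo_log (ht : 0 < t) : ∫ s in Ioo 0 t, Real.log s = t * Real.log t - t := by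
  rw [← integral_Ioc_eq_integral_Ioo, ← intervalIntegral.integral_of_le ht.le, integral_log]
  simp

/-- The integrand is the derivative of `s * boxCox r (t / s)`, which vanishes at both ends. -/
lemma integrableOn_and_integral_boxCox_div_sub_rpow (hr : r < 1) (ht : 0 < t) :
    IntegrableOn (fun s => boxCox r (t / s) - (t / s) ^ r) (Ioo 0 t) ∧
      ∫ s in Ioo 0 t, (boxCox r (t / s) - (t / s) ^ r) = 0 := by
  have integrable_const (c : ℝ) : IntegrableOn (fun _ => c) (Ioo 0 t) :=
    integrableOn_const (by simp)
  have volume_Ioo : volume.real (Ioo 0 t) = t := by simp [ht.le]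
  rcases eq_or_ne r 0 with rfl | hr0
  · have heq : EqOn (fun s => Real.log t - 1 - Real.log s)
        (fun s => boxCox 0 (t / s) - (t / s) ^ (0 : ℝ)) (Ioo 0 t) := fun s hs => by
      simp only [boxCox_zero, Real.log_div ht.ne' hs.1.ne', Real.rpow_zero]
      ring
    refine ⟨((integrable_const _).sub (integrableOn_Ioo_log ht)).congr_fun heq measurableSet_Ioo,
      ?_⟩
    rw [← setIntegral_congr_fun measurableSet_Ioo heq, integral_sub (integrable_const _)
      (integrableOn_Ioo_log ht), integral_Ioo_log ht, setIntegral_const, volume_Ioo, smul_eq_mul]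
    ring
  · have heq : EqOn (fun s => (1 - r) / r * t ^ r * s ^ (-r) - 1 / r)
        (fun s => boxCox r (t / s) - (t / s) ^ r) (Ioo 0 t) := fun s hs => by
      simp only [boxCox_of_ne hr0, Real.div_rpow ht.le hs.1.le, Real.rpow_neg hs.1.le]
      have := (Real.rpow_pos_of_pos hs.1 r).ne'
      field_simp
      ring
    have integrable_rpow : IntegrableOn (fun s => (1 - r) / r * t ^ r * s ^ (-r)) (Ioo 0 t) :=
      (integrableOn_Ioo_rpow (by linarith) ht).const_mul _
    refine ⟨IntegrableOn.congr_fun (integrable_rpow.sub (integrable_const _)) heq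
      measurableSet_Ioo, ?_⟩
    have hr1 : 1 - r ≠ 0 := (sub_pos.2 hr).ne'
    rw [← setIntegral_congr_fun measurableSet_Ioo heq, integral_sub integrable_rpow
      (integrable_const _), integral_const_mul, integral_Ioo_rpow (by linarith) ht,
      setIntegral_const, volume_Ioo, smul_eq_mul, Real.rpow_add ht, Real.rpow_neg ht.le,
      Real.rpow_one, neg_add_eq_sub]
    have := (Real.rpow_pos_of_pos ht r).ne'
    field_simp
    ring

/-- The average of `f` over `[0, t)` for a kernel that has mass `1` both in `s` (up to a constant
factor) and in `t`. The kernel is chosen so that `hardyConst r 0 * weightedAverage r f t` dominates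
the power mean of order `r` with equality for `f s = 1 / s`, the limit of the extremal functions. -/
noncomputable def weightedAverage (r : ℝ) (f : ℝ → ℝ) (t : ℝ) : ℝ :=
  (1 - r) * t ^ (r - 2) * ∫ s in Ioo 0 t, s ^ (1 - r) * f s

lemma InL.integrableOn_rpow_mul (hf : InL (Ioi 0) (Ici 0) f) (hr : r < 1) (t : ℝ) :
    IntegrableOn (fun s => s ^ (1 - r) * f s) (Ioo 0 t) := by
  refine Integrable.bdd_mul (c := t ^ (1 - r))
    (hf.1.mono_set fun s hs => mem_Ici.2 hs.1.le) (measurable_rpow_const _).aestronglyMeasurable ?_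
  filter_upwards [ae_restrict_mem measurableSet_Ioo] with s hs
  rw [Real.norm_of_nonneg (Real.rpow_nonneg hs.1.le _)]
  exact Real.rpow_le_rpow hs.1.le hs.2.le (sub_pos.2 hr).le

lemma weightedAverage_pos (hf : InL (Ioi 0) (Ici 0) f) (hr : r < 1) (ht : 0 < t) :
    0 < weightedAverage r f t := by
  have restrict_ne_zero : volume.restrict (Ioo 0 t) ≠ 0 := by simpa using ht
  have pos_ae : ∀ᵐ s ∂volume.restrict (Ioo 0 t), 0 < s ^ (1 - r) * f s := by
    filter_upwards [ae_restrict_mem measurableSet_Ioo] with s hs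
    exact mul_pos (Real.rpow_pos_of_pos hs.1 _) (hf.2 hs.1.le)
  exact mul_pos (mul_pos (sub_pos.2 hr) (Real.rpow_pos_of_pos ht _))
    (integral_pos_of_ae_pos restrict_ne_zero (hf.integrableOn_rpow_mul hr t) pos_ae)

lemma boxCox_div_le_of_mem_Ioo {a s x : ℝ} (hr : r < 1) (ha : 0 < a) (hx : 0 < x)
    (hs : s ∈ Ioo 0 t) :
    boxCox r (x / a) ≤
      boxCox r (t / s) - (t / s) ^ r + t ^ (r - 1) / a * (s ^ (1 - r) * x) := by
  have hs0 := hs.1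
  have ht : 0 < t := hs.1.trans hs.2
  refine (boxCox_le_tangent hr.le (div_pos hx ha) (div_pos ht hs0)).trans_eq ?_
  rw [Real.div_rpow ht.le hs0.le, Real.rpow_sub ht, Real.rpow_sub hs0, Real.rpow_one, Real.rpow_one]
  have := (Real.rpow_pos_of_pos hs0 r).ne'
  field_simp
  ring

lemma GiniIntegrable.giniMean_zero_le_weightedAverage (hf : InL (Ioi 0) (Ici 0) f) (hr : r < 1)
    (ht : 0 < t) (h : GiniIntegrable r 0 (volume.restrict (Ioo 0 t)) f) :
    giniMean r 0 (volume.restrict (Ioo 0 t)) f ≤ hardyConst r 0 * weightedAverage r f t := by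
  have hC := hardyConst_pos hr one_pos
  have ha := weightedAverage_pos hf hr ht
  set a := weightedAverage r f t with ha_def
  have : 0 < 1 - r := sub_pos.2 hr
  obtain ⟨tangent_int, tangent_integral⟩ := integrableOn_and_integral_boxCox_div_sub_rpow hr ht
  have linear_int :
      IntegrableOn (fun s => t ^ (r - 1) / a * (s ^ (1 - r) * f s)) (Ioo 0 t) :=
    (hf.integrableOn_rpow_mul hr t).const_mul _
  have linear_integral :
      (1 - r) * ∫ s in Ioo 0 t, t ^ (r - 1) / a * (s ^ (1 - r) * f s) = t := by
    rw [integral_const_mul]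
    have : t ^ (r - 1) = t ^ (r - 2) * t := by rw [← Real.rpow_add_one ht.ne']; ring_nf
    rw [this]
    have : a = (1 - r) * t ^ (r - 2) * ∫ s in Ioo 0 t, s ^ (1 - r) * f s := ha_def
    field_simp
    linarith
  have bound_int : IntegrableOn (fun s => (1 - r) * (boxCox r (t / s) - (t / s) ^ r +
      t ^ (r - 1) / a * (s ^ (1 - r) * f s))) (Ioo 0 t) :=
    (tangent_int.add linear_int).const_mul _
  have one_int : IntegrableOn (fun _ => (1 : ℝ)) (Ioo 0 t) := integrableOn_const (by simp)
  rw [h.giniMean_zero_le_iff (mul_pos hC ha)]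
  calc ∫ s in Ioo 0 t, boxCox r (f s / (hardyConst r 0 * a))
      ≤ ∫ s in Ioo 0 t, ((1 - r) * (boxCox r (t / s) - (t / s) ^ r +
          t ^ (r - 1) / a * (s ^ (1 - r) * f s)) - 1) := by
        refine setIntegral_mono_on ?_ (bound_int.sub one_int) measurableSet_Ioo fun s hs => ?_
        · simpa [IntegrableOn] using h.integrable_rpow_mul_boxCox_div (mul_pos hC ha)
        · have hfs : 0 < f s := hf.2 hs.1.le
          rw [mul_comm, ← div_div, boxCox_div_hardyConst hr (div_pos hfs ha)]
          gcongr
          exact boxCox_div_le_of_mem_Ioo hr ha hfs hs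
    _ = ((1 - r) * ∫ s in Ioo 0 t, t ^ (r - 1) / a * (s ^ (1 - r) * f s)) - t := by
        rw [integral_sub bound_int one_int, integral_const_mul, integral_add tangent_int linear_int,
          tangent_integral]
        simp [ht.le]
    _ ≤ 0 := by rw [linear_integral, sub_self]

/-- The kernel of `weightedAverage` as a measurable function of both variables. -/
noncomputable def averageKernel (r t s : ℝ) : ℝ≥0∞ :=
  {x : ℝ × ℝ | x.2 < x.1}.indicator
    (fun x => ENNReal.ofReal ((1 - r) * x.1 ^ (r - 2) * x.2 ^ (1 - r))) (t, s)

lemma measurable_averageKernel (r : ℝ) : Measurable (Function.uncurry (averageKernel r)) :=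
  ((measurable_const.mul (measurable_fst.pow_const _)).mul
    (measurable_snd.pow_const _)).ennreal_ofReal.indicator
    (measurableSet_lt measurable_snd measurable_fst)

lemma lintegral_averageKernel (hr : r < 1) {s : ℝ} (hs : 0 < s) :
    ∫⁻ t in Ioi (0 : ℝ), averageKernel r t s = 1 := by
  have : 0 < 1 - r := sub_pos.2 hr
  have kernel_eq : (averageKernel r · s) =
      (Ioi s).indicator fun t => ENNReal.ofReal ((1 - r) * t ^ (r - 2) * s ^ (1 - r)) := rfl
  have kernel_int : IntegrableOn (fun t => (1 - r) * t ^ (r - 2) * s ^ (1 - r)) (Ioi s) :=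
    ((integrableOn_Ioi_rpow_of_lt (by linarith) hs).const_mul _).mul_const _
  rw [kernel_eq, setLIntegral_indicator measurableSet_Ioi, Ioi_inter_Ioi, max_eq_left hs.le,
    ← ofReal_integral_eq_lintegral_ofReal kernel_int, ENNReal.ofReal_eq_one, integral_mul_const,
    integral_const_mul, integral_Ioi_rpow_of_lt (by linarith) hs]
  · have hinv : s ^ (r - 2 + 1) * s ^ (1 - r) = 1 := by rw [← Real.rpow_add hs]; ring_nf; simp
    have : r - 2 + 1 ≠ 0 := by linarith
    field_simp
    linear_combination (r - 1) * hinv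
  · filter_upwards [ae_restrict_mem measurableSet_Ioi] with t ht
    have : 0 < t := hs.trans ht
    simp only [Pi.zero_apply]
    positivity

lemma ofReal_weightedAverage (hf : InL (Ioi 0) (Ici 0) f) (hr : r < 1) (ht : 0 < t) :
    ENNReal.ofReal (weightedAverage r f t) =
      ∫⁻ s in Ioi (0 : ℝ), averageKernel r t s * ENNReal.ofReal (f s) := by
  have : 0 < 1 - r := sub_pos.2 hr
  have kernel_eq : (fun s => averageKernel r t s * ENNReal.ofReal (f s)) =
      (Iio t).indicator fun s =>
        ENNReal.ofReal ((1 - r) * t ^ (r - 2) * s ^ (1 - r)) * ENNReal.ofReal (f s) := by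
    ext s
    by_cases hst : s < t <;> simp [averageKernel, hst]
  rw [kernel_eq, setLIntegral_indicator measurableSet_Iio, Iio_inter_Ioi, weightedAverage,
    ← integral_const_mul, ofReal_integral_eq_lintegral_ofReal
      ((hf.integrableOn_rpow_mul hr t).const_mul _)]
  · refine setLIntegral_congr_fun measurableSet_Ioo fun s hs => ?_
    have := Real.rpow_nonneg hs.1.le (1 - r)
    rw [← ENNReal.ofReal_mul (by positivity), mul_assoc ((1 - r) * _)]
  · filter_upwards [ae_restrict_mem measurableSet_Ioo] with s hs
    have hfs : 0 < f s := hf.2 hs.1.le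
    have := Real.rpow_nonneg hs.1.le (1 - r)
    simp only [Pi.zero_apply]
    positivity

lemma aemeasurable_averageKernel_mul (hf : InL (Ioi 0) (Ici 0) f) :
    AEMeasurable (Function.uncurry fun t s => averageKernel r t s * ENNReal.ofReal (f s))
      ((volume.restrict (Ioi 0)).prod (volume.restrict (Ioi 0))) := by
  have hf' : AEMeasurable f (volume.restrict (Ioi 0)) :=
    (hf.1.mono_set Ioi_subset_Ici_self).aestronglyMeasurable.aemeasurable
  exact (measurable_averageKernel r).aemeasurable.mul hf'.comp_snd.ennreal_ofReal

lemma aemeasurable_ofReal_weightedAverage (hf : InL (Ioi 0) (Ici 0) f) (hr : r < 1) :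
    AEMeasurable (fun t => ENNReal.ofReal (weightedAverage r f t)) (volume.restrict (Ioi 0)) := by
  refine (aemeasurable_averageKernel_mul (r := r) hf).lintegral_prod_right'.congr ?_
  filter_upwards [ae_restrict_mem measurableSet_Ioi] with t ht
  exact (ofReal_weightedAverage hf hr ht).symm

lemma lintegral_weightedAverage (hf : InL (Ioi 0) (Ici 0) f) (hr : r < 1) :
    ∫⁻ t in Ioi (0 : ℝ), ENNReal.ofReal (weightedAverage r f t) =
      ∫⁻ t in Ioi (0 : ℝ), ENNReal.ofReal (f t) := by
  rw [setLIntegral_congr_fun measurableSet_Ioi fun t ht => ofReal_weightedAverage hf hr ht,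
    lintegral_lintegral_swap (aemeasurable_averageKernel_mul hf)]
  refine setLIntegral_congr_fun measurableSet_Ioi fun s hs => ?_
  rw [lintegral_mul_const' _ _ ENNReal.ofReal_ne_top, lintegral_averageKernel hr hs, one_mul]

end WeightedAverage

section IntegralUpper

variable {p q : ℝ} {J : Set ℝ} {f : ℝ → ℝ}

/-- The set of all constants in the integral Hardy inequality for `integralGini p q`, the least
element of which is the integral Hardy constant. -/
def integralHardyBounds (p q : ℝ) : Set ℝ≥0∞ :=
  {H : ℝ≥0∞ | ∀ f : ℝ → ℝ, InL (Ioi 0) (Ici 0) f → (∀ t : ℝ, 0 < t → giniDom p q (Ico 0 t) f) →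
    ∫⁻ t in Ioi (0 : ℝ), ENNReal.ofReal (integralGini p q (Ico 0 t) f) ≤
      H * ∫⁻ t in Ioi (0 : ℝ), ENNReal.ofReal (f t)}

lemma integralHardyBounds_comm (p q : ℝ) : integralHardyBounds p q = integralHardyBounds q p := by
  have subset (p q : ℝ) : integralHardyBounds p q ⊆ integralHardyBounds q p := fun H hH f hf hdom =>
    (setLIntegral_congr_fun measurableSet_Ioi fun t ht => by
      simp only [integralGini_comm (hdom t ht)]).trans_le
      (hH f hf fun t ht => (hdom t ht).symm)
  exact (subset p q).antisymm (subset q p)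

namespace giniDom

lemma zero_right (h : giniDom p q J f) (hp : p ≠ 0) : giniDom p 0 J f := by
  refine ⟨h.1, h.2.1, h.2.2.1, fun _ => ?_, fun hp0 => absurd hp0 hp⟩
  simpa using integrableOn_const (C := (1 : ℝ)) h.1.volume_lt_top.ne

lemma giniIntegrable_Ioo {t : ℝ} (h : giniDom p q (Ico 0 t) f) :
    GiniIntegrable p q (volume.restrict (Ioo 0 t)) f := by
  rw [Measure.restrict_congr_set Ioo_ae_eq_Ico]
  exact h.giniIntegrable

lemma integralGini_zero_le_weightedAverage {r t : ℝ} (hf : InL (Ioi 0) (Ici 0) f) (hr : r < 1)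
    (ht : 0 < t) (h : giniDom r 0 (Ico 0 t) f) :
    integralGini r 0 (Ico 0 t) f ≤ hardyConst r 0 * weightedAverage r f t := by
  rw [integralGini_eq_giniMean, ← Measure.restrict_congr_set Ioo_ae_eq_Ico]
  exact h.giniIntegrable_Ioo.giniMean_zero_le_weightedAverage hf hr ht

end giniDom

lemma exists_integralGini_le_weightedAverage (hq : q ≤ 0) (hp0 : 0 ≤ p) (hp : p < 1) :
    ∃ a b : ℝ, 0 ≤ a ∧ 0 ≤ b ∧ a + b = 1 ∧ ∀ f, InL (Ioi 0) (Ici 0) f → ∀ t, 0 < t →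
      giniDom p q (Ico 0 t) f → integralGini p q (Ico 0 t) f ≤
        hardyConst p q * (a * weightedAverage p f t + b * weightedAverage q f t) := by
  have hq1 : q < 1 := hq.trans_lt one_pos
  rcases hq.eq_or_lt with rfl | hq
  · refine ⟨1, 0, zero_le_one, le_rfl, add_zero 1, fun f hf t ht h => ?_⟩
    simpa using h.integralGini_zero_le_weightedAverage hf hp ht
  rcases hp0.eq_or_lt with rfl | hp0
  · refine ⟨0, 1, le_rfl, zero_le_one, zero_add 1, fun f hf t ht h => ?_⟩
    rw [integralGini_comm h, hardyConst_comm hp hq1]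
    simpa using h.symm.integralGini_zero_le_weightedAverage hf hq1 ht
  have hsub : 0 < p - q := sub_pos.2 (hq.trans hp0)
  refine ⟨p / (p - q), -q / (p - q), by positivity, div_nonneg (neg_nonneg.2 hq.le) hsub.le,
    by field_simp; ring, fun f hf t ht h => ?_⟩
  have hpdom := h.zero_right hp0.ne'
  have hqdom := h.symm.zero_right hq.ne
  exact h.giniIntegrable.giniMean_le_hardyConst_mul hpdom.giniIntegrable hqdom.giniIntegrable
    (hq.trans hp0).ne' hp0.le hp hq.le (hpdom.integralGini_zero_le_weightedAverage hf hp ht)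
    (hqdom.integralGini_zero_le_weightedAverage hf hq1 ht)

lemma lintegral_linearComb_weightedAverage (hf : InL (Ioi 0) (Ici 0) f)
    {r s a b C : ℝ} (hr : r < 1) (hs : s < 1) (ha : 0 ≤ a) (hb : 0 ≤ b) (hab : a + b = 1)
    (hC : 0 ≤ C) :
    ∫⁻ t in Ioi (0 : ℝ),
        ENNReal.ofReal (C * (a * weightedAverage r f t + b * weightedAverage s f t)) =
      ENNReal.ofReal C * ∫⁻ t in Ioi (0 : ℝ), ENNReal.ofReal (f t) := by
  have ofReal_linearComb : ∀ t ∈ Ioi (0 : ℝ),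
      ENNReal.ofReal (C * (a * weightedAverage r f t + b * weightedAverage s f t)) =
        ENNReal.ofReal C * (ENNReal.ofReal a * ENNReal.ofReal (weightedAverage r f t) +
          ENNReal.ofReal b * ENNReal.ofReal (weightedAverage s f t)) := fun t ht => by
    rw [ENNReal.ofReal_mul hC, ENNReal.ofReal_add (mul_nonneg ha (weightedAverage_pos hf hr ht).le)
      (mul_nonneg hb (weightedAverage_pos hf hs ht).le), ENNReal.ofReal_mul ha,
      ENNReal.ofReal_mul hb]
  rw [setLIntegral_congr_fun measurableSet_Ioi ofReal_linearComb,
    lintegral_const_mul' _ _ ENNReal.ofReal_ne_top,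
    lintegral_add_left' ((aemeasurable_ofReal_weightedAverage hf hr).const_mul _),
    lintegral_const_mul' _ _ ENNReal.ofReal_ne_top, lintegral_const_mul' _ _ ENNReal.ofReal_ne_top,
    lintegral_weightedAverage hf hr, lintegral_weightedAverage hf hs, ← add_mul,
    ← ENNReal.ofReal_add ha hb, hab, ENNReal.ofReal_one, one_mul]

lemma ofReal_hardyConst_mem_integralHardyBounds (hq : q ≤ 0) (hp0 : 0 ≤ p) (hp : p < 1) :
    ENNReal.ofReal (hardyConst p q) ∈ integralHardyBounds p q := fun f hf hdom => by
  have hq1 : q < 1 := hq.trans_lt one_pos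
  obtain ⟨a, b, ha, hb, hab, hle⟩ := exists_integralGini_le_weightedAverage hq hp0 hp
  rw [← lintegral_linearComb_weightedAverage hf hp hq1 ha hb hab (hardyConst_pos hp hq1).le]
  exact setLIntegral_mono' measurableSet_Ioi fun t ht =>
    ENNReal.ofReal_le_ofReal (hle f hf t ht (hdom t ht))

lemma abs_log_le {x r : ℝ} (hx : 0 < x) (hr : r < 0) : |Real.log x| ≤ x + (-r)⁻¹ * x ^ r := by
  have hr' : 0 < -r := neg_pos.2 hr
  have hpow := Real.rpow_pos_of_pos hx r
  have log_le := Real.log_le_sub_one_of_pos hx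
  have neg_log_le : -Real.log x ≤ (-r)⁻¹ * x ^ r := by
    have := Real.log_le_sub_one_of_pos hpow
    rw [Real.log_rpow hx] at this
    rw [inv_mul_eq_div, le_div_iff₀ hr']
    linarith
  have : 0 < (-r)⁻¹ * x ^ r := by positivity
  exact abs_le.2 ⟨by linarith, by linarith⟩

lemma giniDom.integrableOn_log (h : giniDom p q J f) (hp : p < 0) :
    IntegrableOn (fun t => Real.log (f t)) J := by
  refine Integrable.mono' (h.2.1.1.add (h.2.2.1.const_mul (-p)⁻¹))
    (Real.measurable_log.comp_aemeasurable
      h.2.1.1.aestronglyMeasurable.aemeasurable).aestronglyMeasurable ?_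
  filter_upwards [ae_restrict_mem h.1.measurableSet] with t ht
  exact abs_log_le (h.2.1.2 ht) hp

lemma giniDom.zero_zero (h : giniDom p q J f) (hp : p ≤ 0) (hq : q ≤ 0) : giniDom 0 0 J f := by
  rcases hp.eq_or_lt with rfl | hp'
  · rcases hq.eq_or_lt with rfl | hq'
    · exact h
    · refine ⟨h.1, h.2.1, h.2.2.1, fun h0 => absurd rfl h0, fun _ => ?_⟩
      simpa using h.symm.integrableOn_log hq'
  · have h0 := (h.zero_right hp'.ne).2.2.2.1 hp'.ne
    exact ⟨h.1, h.2.1, h0, fun _ => h0, fun _ => by simpa using h.integrableOn_log hp'⟩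

lemma integralHardyBounds_zero_zero_subset (hp : p ≤ 0) (hq : q ≤ 0) :
    integralHardyBounds 0 0 ⊆ integralHardyBounds p q := fun H hH f hf hdom => by
  have hdom₀ (t : ℝ) (ht : 0 < t) : giniDom 0 0 (Ico 0 t) f := (hdom t ht).zero_zero hp hq
  exact (setLIntegral_mono' measurableSet_Ioi fun t ht => ENNReal.ofReal_le_ofReal <|
    (hdom t ht).giniIntegrable.giniMean_le_giniMean_zero_zero (hdom₀ t ht).giniIntegrable
      hp hq).trans (hH f hf hdom₀)

lemma ofReal_exp_one_mem_integralHardyBounds (hp : p ≤ 0) (hq : q ≤ 0) :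
    ENNReal.ofReal (Real.exp 1) ∈ integralHardyBounds p q := by
  rw [← hardyConst_self 0]
  exact integralHardyBounds_zero_zero_subset hp hq
    (ofReal_hardyConst_mem_integralHardyBounds le_rfl le_rfl one_pos)

lemma lintegral_ofReal_ne_zero (hf : InL (Ioi 0) (Ici 0) f) :
    ∫⁻ t in Ioi (0 : ℝ), ENNReal.ofReal (f t) ≠ 0 := by
  have h_int := hf.1.mono_set Ioi_subset_Ici_self
  have hpos : ∀ᵐ t ∂volume.restrict (Ioi 0), 0 < f t := by
    filter_upwards [ae_restrict_mem measurableSet_Ioi] with t ht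
    exact hf.2 (mem_Ioi.1 ht).le
  rw [← ofReal_integral_eq_lintegral_ofReal h_int (hpos.mono fun t ht => ht.le)]
  exact (ENNReal.ofReal_pos.2 (integral_pos_of_ae_pos (by simp) h_int hpos)).ne'

lemma lintegral_ofReal_ne_top (hf : InL (Ioi 0) (Ici 0) f) :
    ∫⁻ t in Ioi (0 : ℝ), ENNReal.ofReal (f t) ≠ ⊤ :=
  (hf.1.mono_set Ioi_subset_Ici_self).lintegral_lt_top.ne

lemma top_mem_integralHardyBounds (p q : ℝ) : ⊤ ∈ integralHardyBounds p q := fun f hf _ => by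
  rw [ENNReal.top_mul (lintegral_ofReal_ne_zero hf)]
  exact le_top

lemma sInf_mem_integralHardyBounds (p q : ℝ) :
    sInf (integralHardyBounds p q) ∈ integralHardyBounds p q := fun f hf hdom => by
  have div_le_iff {a b : ℝ≥0∞} : a / (∫⁻ t in Ioi (0 : ℝ), ENNReal.ofReal (f t)) ≤ b ↔
      a ≤ b * ∫⁻ t in Ioi (0 : ℝ), ENNReal.ofReal (f t) :=
    ENNReal.div_le_iff (lintegral_ofReal_ne_zero hf) (lintegral_ofReal_ne_top hf)
  exact div_le_iff.1 (le_sInf fun H hH => div_le_iff.2 (hH f hf hdom))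

theorem exists_isIntegralHardyConst_le_exp_one (h : max p q ≤ 0) :
    ∃ C : ℝ≥0∞, C ≤ ENNReal.ofReal (Real.exp 1) ∧ C < ⊤ ∧
      IsIntegralHardyConst (Ioi 0) (giniDom p q) (integralGini p q) C := by
  obtain ⟨hp, hq⟩ := max_le_iff.1 h
  have hle := sInf_le (ofReal_exp_one_mem_integralHardyBounds hp hq)
  exact ⟨_, hle, hle.trans_lt ENNReal.ofReal_lt_top, sInf_mem_integralHardyBounds p q,
    fun _ hH => sInf_le hH⟩

end IntegralUpper

/-! ### Sharpness of the Hardy constants -/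

section DiscreteLower

variable {p q z : ℝ} {H : ℝ≥0∞} {x w : ℕ → ℝ}

lemma top_mem_hardyBounds (M : WeightedOp) : ⊤ ∈ hardyBounds M := fun x w hx hw => by
  have sum_ne_zero : ∑' n, ENNReal.ofReal (w n * x n) ≠ 0 := fun hsum =>
    (ENNReal.ofReal_pos.2 (mul_pos (hw 0) (hx 0).1)).ne' (ENNReal.tsum_eq_zero.1 hsum 0)
  rw [ENNReal.top_mul sum_ne_zero]
  exact le_top

lemma giniMean_weightMeasure_congr (hw : ∀ n, 0 < w n) {y : ℕ → ℝ} {n : ℕ}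
    (hxy : ∀ i < n, x i = y i) :
    giniMean p q (weightMeasure w n) x = giniMean p q (weightMeasure w n) y := by
  have integral_congr (φ : ℝ → ℝ) :
      ∫ i, φ (x i) ∂weightMeasure w n = ∫ i, φ (y i) ∂weightMeasure w n := by
    rw [integral_weightMeasure hw, integral_weightMeasure hw]
    exact Finset.sum_congr rfl fun i hi => by rw [hxy i (Finset.mem_range.1 hi)]
  rw [giniMean, giniMean, integral_congr fun t => t ^ p * Real.log t, integral_congr (· ^ p),
    integral_congr (· ^ q)]

lemma le_of_sum_range_le_mul_add {u : ℕ → ℝ≥0∞} {C L : ℝ≥0∞} (hC : C ≠ ⊤)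
    (hsum : ∀ N : ℕ, ∑ n ∈ Finset.range N, u n ≤ H * (N + C)) (hu : Tendsto u atTop (𝓝 L)) :
    L ≤ H := by
  refine le_of_forall_lt_imp_le_of_dense fun b hb => ?_
  obtain ⟨n₀, hn₀⟩ := eventually_atTop.1 (hu.eventually_const_lt hb)
  have average_bound : ∀ᶠ M : ℕ in atTop, b ≤ H * (1 + (n₀ + C) * (M : ℝ≥0∞)⁻¹) := by
    filter_upwards [eventually_gt_atTop 0] with M hM
    have hM0 : (M : ℝ≥0∞) ≠ 0 := Nat.cast_ne_zero.2 hM.ne'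
    have hMtop : (M : ℝ≥0∞) ≠ ⊤ := ENNReal.natCast_ne_top M
    have bound : b * M ≤ H * (M + (n₀ + C)) := calc
      b * M = ∑ _n ∈ Finset.range M, b := by simp [mul_comm]
      _ ≤ ∑ n ∈ Finset.range M, u (n₀ + n) :=
        Finset.sum_le_sum fun n _ => (hn₀ _ (Nat.le_add_right _ _)).le
      _ ≤ ∑ n ∈ Finset.range (n₀ + M), u n := by
        rw [Finset.sum_range_add]
        exact le_add_self
      _ ≤ H * (M + (n₀ + C)) := (hsum _).trans_eq (by push_cast; ring)
    calc b ≤ H * (M + (n₀ + C)) / M := (ENNReal.le_div_iff_mul_le (.inl hM0) (.inl hMtop)).2 bound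
      _ = H * (1 + (n₀ + C) * (M : ℝ≥0∞)⁻¹) := by
        rw [mul_div_assoc, ENNReal.add_div, ENNReal.div_self hM0 hMtop, div_eq_mul_inv]
  rcases eq_or_ne H ⊤ with rfl | hH
  · exact le_top
  have hlim : Tendsto (fun M : ℕ => H * (1 + (n₀ + C) * (M : ℝ≥0∞)⁻¹)) atTop (𝓝 H) := by
    have := ENNReal.Tendsto.const_mul (tendsto_const_nhds (x := (1 : ℝ≥0∞)) |>.add
      (ENNReal.Tendsto.const_mul (a := n₀ + C) ENNReal.tendsto_inv_nat_nhds_zero (.inr (by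
        simpa using hC)))) (.inr hH)
    simpa using this
  exact ge_of_tendsto hlim average_bound

/-- Replacing `x n`, for `n ≥ N`, by terms whose weighted sum is at most `2` makes the right-hand
side of Hardy's inequality finite without changing the first `N` means. -/
lemma sum_range_le_of_mem_hardyBounds_gini (hH : H ∈ hardyBounds (gini p q)) (hx : ∀ n, 0 < x n)
    (hw : ∀ n, 0 < w n) (hwx : ∀ n, w n * x n = 1) (N : ℕ) :
    ∑ n ∈ Finset.range N, ENNReal.ofReal (w n * giniMean p q (weightMeasure w (n + 1)) x) ≤
      H * (N + 2) := by
  set y : ℕ → ℝ := fun n => if n < N then x n else 2⁻¹ ^ n / w n with hy_def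
  have hy (n : ℕ) : 0 < y n := by
    have := hw n
    simp only [hy_def]
    split_ifs
    · exact hx n
    · positivity
  have hwy (n : ℕ) : ENNReal.ofReal (w n * y n) ≤
      (if n ∈ Finset.range N then 1 else 0) + 2⁻¹ ^ n := by
    by_cases hn : n < N
    · simp [hy_def, hn, hwx]
    · simp only [hy_def, hn, if_false, mul_div_cancel₀ _ (hw n).ne', Finset.mem_range, zero_add]
      rw [ENNReal.ofReal_pow (by positivity), ENNReal.ofReal_inv_of_pos two_pos,
        ENNReal.ofReal_ofNat]
  calc ∑ n ∈ Finset.range N, ENNReal.ofReal (w n * giniMean p q (weightMeasure w (n + 1)) x)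
      = ∑ n ∈ Finset.range N, ENNReal.ofReal (w n * giniMean p q (weightMeasure w (n + 1)) y) := by
        refine Finset.sum_congr rfl fun n hn => ?_
        rw [giniMean_weightMeasure_congr hw fun i hi => ?_]
        have := Finset.mem_range.1 hn
        simp only [hy_def, if_pos (show i < N by omega)]
    _ ≤ ∑' n, ENNReal.ofReal (w n * giniMean p q (weightMeasure w (n + 1)) y) :=
        ENNReal.sum_le_tsum _
    _ ≤ H * ∑' n, ENNReal.ofReal (w n * y n) := mem_hardyBounds_gini_iff.1 hH y w hy hw
    _ ≤ H * ∑' n, ((if n ∈ Finset.range N then 1 else 0) + 2⁻¹ ^ n) := by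
        gcongr with n
        exact hwy n
    _ = H * (N + 2) := by
        rw [ENNReal.tsum_add, ENNReal.tsum_geometric, tsum_eq_sum fun n hn => if_neg hn,
          Finset.sum_congr rfl fun n hn => if_pos hn, Finset.sum_const, Finset.card_range,
          nsmul_one, ENNReal.one_sub_inv_two, inv_inv]

lemma le_of_mem_hardyBounds_gini_of_tendsto {L : ℝ≥0∞} (hH : H ∈ hardyBounds (gini p q))
    (hx : ∀ n, 0 < x n) (hw : ∀ n, 0 < w n) (hwx : ∀ n, w n * x n = 1)
    (hL : Tendsto (fun n => ENNReal.ofReal (w n * giniMean p q (weightMeasure w (n + 1)) x)) atTop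
      (𝓝 L)) : L ≤ H :=
  le_of_sum_range_le_mul_add ENNReal.ofNat_ne_top
    (sum_range_le_of_mem_hardyBounds_gini hH hx hw hwx) hL

lemma integral_geometric_rpow (hz : 0 < z) (r : ℝ) (n : ℕ) :
    ∫ i, (z ^ i) ^ r ∂weightMeasure (fun i => (z ^ i)⁻¹) (n + 1) =
      (z ^ n) ^ (r - 1) * ∑ i ∈ Finset.range (n + 1), (z ^ (1 - r)) ^ i := by
  rw [integral_weightMeasure fun i => inv_pos.2 (pow_pos hz i), ← Finset.sum_range_reflect,
    Finset.mul_sum]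
  refine Finset.sum_congr rfl fun i hi => ?_
  obtain ⟨k, rfl⟩ := Nat.exists_eq_add_of_le (Nat.lt_succ_iff.1 (Finset.mem_range.1 hi))
  have hk : i + k + 1 - 1 - i = k := by omega
  rw [hk, ← Real.rpow_natCast z k, ← Real.rpow_natCast z (i + k), ← Real.rpow_natCast _ i,
    ← Real.rpow_neg hz.le, ← Real.rpow_mul hz.le, ← Real.rpow_mul hz.le, ← Real.rpow_mul hz.le,
    ← Real.rpow_add hz, ← Real.rpow_add hz]
  congr 1
  push_cast
  ring

lemma inv_pow_mul_giniMean_geometric (hz : 0 < z) (hpq : p ≠ q) (n : ℕ) :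
    (z ^ n)⁻¹ * giniMean p q (weightMeasure (fun i => (z ^ i)⁻¹) (n + 1)) (fun i => z ^ i) =
      ((∑ i ∈ Finset.range (n + 1), (z ^ (1 - p)) ^ i) /
        ∑ i ∈ Finset.range (n + 1), (z ^ (1 - q)) ^ i) ^ (1 / (p - q)) := by
  have hzn : 0 < z ^ n := pow_pos hz n
  have hsub : p - q ≠ 0 := sub_ne_zero.2 hpq
  set S := fun r : ℝ => ∑ i ∈ Finset.range (n + 1), (z ^ (1 - r)) ^ i
  have hS (r : ℝ) : 0 ≤ S r := Finset.sum_nonneg fun i _ => by positivity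
  have ratio_eq : (z ^ n) ^ (p - 1) * S p / ((z ^ n) ^ (q - 1) * S q) =
      (z ^ n) ^ (p - q) * (S p / S q) := by
    rw [mul_div_mul_comm, ← Real.rpow_sub hzn, sub_sub_sub_cancel_right]
  rw [giniMean, if_neg hpq, integral_geometric_rpow hz, integral_geometric_rpow hz, ratio_eq,
    Real.mul_rpow (by positivity) (div_nonneg (hS p) (hS q)), ← Real.rpow_mul hzn.le,
    mul_one_div_cancel hsub, Real.rpow_one, inv_mul_cancel_left₀ hzn.ne']

lemma tendsto_sum_range_succ_rpow_pow (hz : 0 < z) (hz1 : z < 1) {r : ℝ} (hr : r < 1) :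
    Tendsto (fun n : ℕ => ∑ i ∈ Finset.range (n + 1), (z ^ (1 - r)) ^ i) atTop
      (𝓝 (1 - z ^ (1 - r))⁻¹) :=
  (hasSum_geometric_of_lt_one (Real.rpow_nonneg hz.le _)
    (Real.rpow_lt_one hz.le hz1 (sub_pos.2 hr))).tendsto_sum_nat.comp (tendsto_add_atTop_nat 1)

lemma tendsto_one_sub_rpow_div_one_sub_rpow (a : ℝ) {b : ℝ} (hb : b ≠ 0) :
    Tendsto (fun t : ℝ => (1 - t ^ a) / (1 - t ^ b)) (𝓝[<] 1) (𝓝 (a / b)) := by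
  have slope_tendsto (c : ℝ) : Tendsto (slope (fun t : ℝ => t ^ c) 1) (𝓝[<] 1) (𝓝 c) := by
    have := Real.hasDerivAt_rpow_const (x := 1) (p := c) (.inl one_ne_zero)
    rw [Real.one_rpow, mul_one] at this
    exact (hasDerivAt_iff_tendsto_slope.1 this).mono_left (nhdsWithin_mono _ fun t ht => ht.ne)
  refine ((slope_tendsto a).div (slope_tendsto b) hb).congr' ?_
  filter_upwards [self_mem_nhdsWithin] with t ht
  have : t - 1 ≠ 0 := (sub_neg.2 ht).ne
  rw [Pi.div_apply, slope_def_field, slope_def_field, Real.one_rpow, Real.one_rpow,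
    div_div_div_cancel_right₀ this, ← neg_sub (t ^ a), ← neg_sub (t ^ b), neg_div_neg_eq]

lemma ofReal_hardyConst_le_of_mem_hardyBounds_gini_of_ne (hpq : p ≠ q) (hp : p < 1) (hq : q < 1)
    (hH : H ∈ hardyBounds (gini p q)) : ENNReal.ofReal (hardyConst p q) ≤ H := by
  have hp' : 0 < 1 - p := sub_pos.2 hp
  have hq' : 0 < 1 - q := sub_pos.2 hq
  have bound {z : ℝ} (hz : z ∈ Ioo 0 1) :
      ENNReal.ofReal (((1 - z ^ (1 - q)) / (1 - z ^ (1 - p))) ^ (1 / (p - q))) ≤ H := by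
    have one_sub_pos {r : ℝ} (hr : 0 < r) : 0 < 1 - z ^ r :=
      sub_pos.2 (Real.rpow_lt_one hz.1.le hz.2 hr)
    have hratio := ((tendsto_sum_range_succ_rpow_pow hz.1 hz.2 hp).div
      (tendsto_sum_range_succ_rpow_pow hz.1 hz.2 hq) (inv_pos.2 (one_sub_pos hq')).ne').rpow_const
        (p := 1 / (p - q))
        (.inl (div_pos (inv_pos.2 (one_sub_pos hp')) (inv_pos.2 (one_sub_pos hq'))).ne')
    rw [inv_div_inv] at hratio
    refine le_of_mem_hardyBounds_gini_of_tendsto hH (fun n => pow_pos hz.1 n)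
      (fun n => inv_pos.2 (pow_pos hz.1 n)) (fun n => inv_mul_cancel₀ (pow_pos hz.1 n).ne') ?_
    simp only [inv_pow_mul_giniMean_geometric hz.1 hpq]
    exact ENNReal.tendsto_ofReal hratio
  have hlim := (tendsto_one_sub_rpow_div_one_sub_rpow (1 - q) hp'.ne').rpow_const
    (p := 1 / (p - q)) (.inl (div_pos hq' hp').ne')
  rw [hardyConst_of_ne hpq]
  refine le_of_tendsto (ENNReal.tendsto_ofReal hlim) ?_
  filter_upwards [Ioo_mem_nhdsLT zero_lt_one] with z hz using bound hz

lemma hardyBounds_gini_zero_zero_subset (hq : q ≤ 0) :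
    hardyBounds (gini 0 0) ⊆ hardyBounds (gini 0 q) := fun H hH => by
  rw [mem_hardyBounds_gini_iff] at hH ⊢
  refine fun x w hx hw => (ENNReal.tsum_le_tsum fun n => ?_).trans (hH x w hx hw)
  gcongr
  · exact (hw n).le
  · exact (giniIntegrable_weightMeasure 0 q hx hw n).giniMean_le_giniMean_zero_zero
      (giniIntegrable_weightMeasure 0 0 hx hw n) le_rfl hq

lemma tendsto_hardyConst_zero_neg_inv :
    Tendsto (fun n : ℕ => hardyConst 0 (-(n : ℝ)⁻¹)) atTop (𝓝 (Real.exp 1)) := by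
  refine (Real.tendsto_one_add_div_pow_exp 1).congr' ?_
  filter_upwards [eventually_ne_atTop 0] with n hn
  have hn' : (0 : ℝ) ≠ -(n : ℝ)⁻¹ := (neg_ne_zero.2 (inv_ne_zero (Nat.cast_ne_zero.2 hn))).symm
  rw [hardyConst_of_ne hn', sub_neg_eq_add, sub_neg_eq_add, sub_zero, zero_add, div_one, one_div,
    one_div, inv_inv, Real.rpow_natCast]

lemma ofReal_hardyConst_le_of_mem_hardyBounds_gini (hq : q ≤ 0) (hp0 : 0 ≤ p) (hp : p < 1)
    (hH : H ∈ hardyBounds (gini p q)) : ENNReal.ofReal (hardyConst p q) ≤ H := by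
  rcases eq_or_ne p q with rfl | hpq
  · obtain rfl := le_antisymm hq hp0
    rw [hardyConst_self]
    refine le_of_tendsto (ENNReal.tendsto_ofReal tendsto_hardyConst_zero_neg_inv) ?_
    filter_upwards [eventually_ne_atTop 0] with n hn
    have hn' : -(n : ℝ)⁻¹ < 0 := neg_neg_of_pos (inv_pos.2 (Nat.cast_pos.2 (Nat.pos_of_ne_zero hn)))
    exact ofReal_hardyConst_le_of_mem_hardyBounds_gini_of_ne hn'.ne' one_pos
      (hn'.trans one_pos) (hardyBounds_gini_zero_zero_subset hn'.le hH)
  · exact ofReal_hardyConst_le_of_mem_hardyBounds_gini_of_ne hpq hp (hq.trans_lt one_pos) hH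

theorem isHardyConst_gini (hmin : min p q ≤ 0) (hmax0 : 0 ≤ max p q) (hmax : max p q < 1) :
    IsHardyConst (Ioi 0) (gini p q) (ENNReal.ofReal (hardyConst p q)) := by
  change IsLeast (hardyBounds (gini p q)) _
  wlog hqp : q ≤ p generalizing p q
  · rw [hardyBounds_gini_comm, hardyConst_comm ((le_max_left p q).trans_lt hmax)
      ((le_max_right p q).trans_lt hmax)]
    exact this (min_comm p q ▸ hmin) (max_comm p q ▸ hmax0) (max_comm p q ▸ hmax) (le_of_not_ge hqp)
  rw [min_eq_right hqp] at hmin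
  rw [max_eq_left hqp] at hmax0 hmax
  exact ⟨ofReal_hardyConst_mem_hardyBounds_gini hmin hmax0 hmax,
    fun H => ofReal_hardyConst_le_of_mem_hardyBounds_gini hmin hmax0 hmax⟩

lemma eq_top_of_mem_hardyBounds_gini_of_one_le (hq : q ≤ 0) (hp : 1 ≤ p)
    (hH : H ∈ hardyBounds (gini p q)) : H = ⊤ := by
  have hz : (0 : ℝ) < 2⁻¹ := by norm_num
  have hz1 : (2⁻¹ : ℝ) < 1 := by norm_num
  have hqp : q < p := hq.trans_lt (one_pos.trans_le hp)
  have hq1 : q < 1 := hq.trans_lt one_pos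
  have numerator_tendsto :
      Tendsto (fun n : ℕ => ∑ i ∈ Finset.range (n + 1), ((2⁻¹ : ℝ) ^ (1 - p)) ^ i) atTop atTop := by
    refine tendsto_atTop_mono (fun n => ?_) tendsto_natCast_atTop_atTop
    calc (n : ℝ) ≤ ∑ i ∈ Finset.range (n + 1), 1 := by simp
      _ ≤ _ := Finset.sum_le_sum fun i _ => one_le_pow₀
        (Real.one_le_rpow_of_pos_of_le_one_of_nonpos hz hz1.le (sub_nonpos.2 hp))
  have denominator_tendsto := (tendsto_sum_range_succ_rpow_pow hz hz1 hq1).inv₀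
    (inv_pos.2 (sub_pos.2 (Real.rpow_lt_one hz.le hz1 (sub_pos.2 hq1)))).ne'
  rw [inv_inv] at denominator_tendsto
  have ratio_tendsto := numerator_tendsto.atTop_mul_pos
    (sub_pos.2 (Real.rpow_lt_one hz.le hz1 (sub_pos.2 hq1))) denominator_tendsto
  refine top_le_iff.1 (le_of_mem_hardyBounds_gini_of_tendsto hH (fun n => pow_pos hz n)
    (fun n => inv_pos.2 (pow_pos hz n)) (fun n => inv_mul_cancel₀ (pow_pos hz n).ne') ?_)
  simp only [inv_pow_mul_giniMean_geometric hz hqp.ne', div_eq_mul_inv _ (Finset.sum _ _)]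
  exact ENNReal.tendsto_ofReal_atTop.comp
    ((tendsto_rpow_atTop (one_div_pos.2 (sub_pos.2 hqp))).comp ratio_tendsto)

lemma tendsto_integral_weightMeasure_one {y : ℕ → ℝ} (hy : Integrable y Measure.count) :
    Tendsto (fun n => ∫ i, y i ∂weightMeasure (fun _ => 1) (n + 1)) atTop
      (𝓝 (∫ i, y i ∂Measure.count)) := by
  have hsum : HasSum y (∫ i, y i ∂Measure.count) := by
    rw [integral_countable hy]
    simpa using (integrable_count_iff.1 hy).of_norm.hasSum
  simpa only [integral_weightMeasure (fun _ => one_pos), one_mul, Function.comp_def] using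
    hsum.tendsto_sum_nat.comp (tendsto_add_atTop_nat 1)

lemma exp_neg_rpow (r s : ℝ) : Real.exp (-s) ^ r = Real.exp (-r * s) := by
  rw [← Real.exp_mul]
  ring_nf

lemma giniIntegrable_count_exp_neg (hp : 0 < p) (hq : 0 < q) :
    GiniIntegrable p q Measure.count fun n : ℕ => Real.exp (-n) := by
  have rpow_summable {r : ℝ} (hr : 0 < r) : Summable fun n : ℕ => Real.exp (-n) ^ r := by
    simpa [exp_neg_rpow] using Real.summable_pow_mul_exp_neg_nat_mul 0 hr
  refine ⟨by simp, .of_forall fun n => Real.exp_pos _,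
    integrable_count_iff.2 (rpow_summable hp).norm, integrable_count_iff.2 (rpow_summable hq).norm,
    fun _ => integrable_count_iff.2 (Summable.norm ?_)⟩
  refine (Real.summable_pow_mul_exp_neg_nat_mul 1 hp).neg.congr fun n => ?_
  rw [exp_neg_rpow, Real.log_exp]
  ring

/-- The means of a sequence all of whose relevant powers are summable do not tend to `0`. -/
lemma eq_top_of_mem_hardyBounds_gini_of_pos (hp : 0 < p) (hq : 0 < q)
    (hH : H ∈ hardyBounds (gini p q)) : H = ⊤ := by
  have h := giniIntegrable_count_exp_neg hp hq
  have means_tendsto := tendsto_giniMean h (tendsto_integral_weightMeasure_one h.left)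
    (fun _ => tendsto_integral_weightMeasure_one h.right)
    (fun hpq => tendsto_integral_weightMeasure_one (h.log hpq))
  have hardy := mem_hardyBounds_gini_iff.1 hH (fun n => Real.exp (-n)) (fun _ => 1)
    (fun n => Real.exp_pos _) (fun _ => one_pos)
  simp only [one_mul] at hardy
  have sum_ne_top : ∑' n : ℕ, ENNReal.ofReal (Real.exp (-n)) ≠ ⊤ :=
    Real.summable_exp_neg_nat.tsum_ofReal_ne_top
  by_contra hHtop
  have means_tendsto_zero := ENNReal.tendsto_atTop_zero_of_tsum_ne_top
    (ne_top_of_le_ne_top (ENNReal.mul_ne_top hHtop sum_ne_top) hardy)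
  exact (ENNReal.ofReal_pos.2 h.giniMean_pos).ne
    (tendsto_nhds_unique means_tendsto_zero (ENNReal.tendsto_ofReal means_tendsto))

theorem isHardyConst_gini_top (h : 0 < min p q ∨ 1 ≤ max p q) :
    IsHardyConst (Ioi 0) (gini p q) ⊤ := by
  refine ⟨top_mem_hardyBounds _, fun H (hH : H ∈ hardyBounds (gini p q)) => top_le_iff.2 ?_⟩
  wlog hqp : q ≤ p generalizing p q
  · exact this (by rwa [min_comm, max_comm]) (hardyBounds_gini_comm p q ▸ hH) (le_of_not_ge hqp)
  rw [min_eq_right hqp, max_eq_left hqp] at h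
  rcases lt_or_ge 0 q with hq | hq
  · exact eq_top_of_mem_hardyBounds_gini_of_pos (hq.trans_le hqp) hq hH
  · exact eq_top_of_mem_hardyBounds_gini_of_one_le hq (h.resolve_left hq.not_gt) hH

end DiscreteLower

section IntegralLower

variable {p q r a t : ℝ} {H : ℝ≥0∞} {S : Set ℝ} {f : ℝ → ℝ}

/-- The test functions for the lower bounds: for `a < 1` close to `1`, most of the integral of
`powerTest a` comes from `(0, 1)`, and there its means are multiples of it. The tail only makes the
function integrable. -/
noncomputable def powerTest (a : ℝ) : ℝ → ℝ :=
  (Ioo 0 1).piecewise (fun s => s ^ (-a)) fun s => Real.exp (-s)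

lemma powerTest_of_mem {s : ℝ} (hs : s ∈ Ioo 0 1) : powerTest a s = s ^ (-a) :=
  piecewise_eq_of_mem _ _ _ hs

lemma powerTest_of_one_le {s : ℝ} (hs : 1 ≤ s) : powerTest a s = Real.exp (-s) :=
  piecewise_eq_of_notMem _ _ _ fun h => h.2.not_ge hs

lemma powerTest_pos (a s : ℝ) : 0 < powerTest a s := by
  by_cases hs : s ∈ Ioo (0 : ℝ) 1
  · rw [powerTest_of_mem hs]
    exact Real.rpow_pos_of_pos hs.1 _
  · rw [powerTest, piecewise_eq_of_notMem _ _ _ hs]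
    exact Real.exp_pos _

lemma powerTest_rpow_of_mem {s : ℝ} (hs : s ∈ Ioo 0 1) (r : ℝ) :
    powerTest a s ^ r = s ^ (-(r * a)) := by
  rw [powerTest_of_mem hs, ← Real.rpow_mul hs.1.le, neg_mul, mul_comm]

lemma integrableOn_powerTest_rpow (hra : r * a < 1)
    (hS : IntegrableOn (fun s => Real.exp (-r * s)) S) :
    IntegrableOn (fun s => powerTest a s ^ r) S := by
  have hrpow : IntegrableOn (fun s : ℝ => s ^ (-(r * a))) (Ioo 0 1) (volume.restrict S) :=
    Integrable.mono_measure (integrableOn_Ioo_rpow (by linarith) one_pos)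
      (Measure.restrict_mono_measure Measure.restrict_le_self _)
  refine (Integrable.piecewise measurableSet_Ioo hrpow (Integrable.mono_measure hS
    Measure.restrict_le_self)).congr (.of_forall fun s => ?_)
  by_cases hs : s ∈ Ioo (0 : ℝ) 1
  · simp only [piecewise_eq_of_mem _ _ _ hs, powerTest_rpow_of_mem hs]
  · simp only [powerTest, piecewise_eq_of_notMem _ _ _ hs, exp_neg_rpow]

lemma inL_powerTest (ha : a < 1) : InL (Ioi 0) (Ici 0) (powerTest a) := by
  refine ⟨?_, fun s _ => powerTest_pos a s⟩
  have exp_int : IntegrableOn (fun s => Real.exp (-1 * s)) (Ici 0) :=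
    (integrableOn_Ici_iff_integrableOn_Ioi (by simp)).2 (exp_neg_integrableOn_Ioi 0 one_pos)
  simpa using integrableOn_powerTest_rpow (r := 1) (by rwa [one_mul]) exp_int

lemma giniDom_powerTest (hpq : p ≠ q) (ha : a < 1) (hpa : p * a < 1) (hqa : q * a < 1)
    (ht : 0 < t) : giniDom p q (Ico 0 t) (powerTest a) := by
  have exp_int (r : ℝ) : IntegrableOn (fun s => Real.exp (-r * s)) (Ico 0 t) :=
    (Continuous.integrableOn_Icc (by fun_prop)).mono_set Ico_subset_Icc_self
  exact ⟨isBddInterval_Ico ht, ⟨(inL_powerTest ha).1.mono_set Ico_subset_Ici_self,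
    fun s _ => powerTest_pos a s⟩, integrableOn_powerTest_rpow hpa (exp_int p),
    fun _ => integrableOn_powerTest_rpow hqa (exp_int q), fun h => absurd h hpq⟩

lemma integral_Ico_powerTest_rpow (hra : r * a < 1) (ht : t ∈ Ioo 0 1) :
    ∫ s in Ico 0 t, powerTest a s ^ r = t ^ (1 - r * a) / (1 - r * a) := by
  rw [integral_Ico_eq_integral_Ioo, setIntegral_congr_fun measurableSet_Ioo fun s hs =>
    powerTest_rpow_of_mem ⟨hs.1, hs.2.trans ht.2⟩ r, integral_Ioo_rpow (by linarith) ht.1,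
    neg_add_eq_sub]

lemma integralGini_powerTest (hpq : p ≠ q) (hpa : p * a < 1) (hqa : q * a < 1) (ht : t ∈ Ioo 0 1) :
    integralGini p q (Ico 0 t) (powerTest a) =
      ((1 - q * a) / (1 - p * a)) ^ (1 / (p - q)) * powerTest a t := by
  have : 0 < 1 - p * a := sub_pos.2 hpa
  have : 0 < 1 - q * a := sub_pos.2 hqa
  have hsub : p - q ≠ 0 := sub_ne_zero.2 hpq
  have ht0 := ht.1
  have ratio_eq : t ^ (1 - p * a) / (1 - p * a) / (t ^ (1 - q * a) / (1 - q * a)) =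
      (1 - q * a) / (1 - p * a) * (t ^ (-a)) ^ (p - q) := by
    have : t ^ (1 - p * a) = t ^ (1 - q * a) * (t ^ (-a)) ^ (p - q) := by
      rw [← Real.rpow_mul ht0.le, ← Real.rpow_add ht0]
      ring_nf
    rw [this]
    have := Real.rpow_pos_of_pos ht0 (1 - q * a)
    field_simp
  rw [integralGini, if_neg hpq, integral_Ico_powerTest_rpow hpa ht,
    integral_Ico_powerTest_rpow hqa ht, ratio_eq, Real.mul_rpow (by positivity) (by positivity),
    ← Real.rpow_mul (by positivity), mul_one_div_cancel hsub, Real.rpow_one, powerTest_of_mem ht]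

lemma lintegral_Ioo_powerTest (ha : a < 1) :
    ∫⁻ s in Ioo 0 1, ENNReal.ofReal (powerTest a s) = ENNReal.ofReal (1 - a)⁻¹ := by
  rw [← ofReal_integral_eq_lintegral_ofReal
    ((inL_powerTest ha).1.mono_set fun s hs => mem_Ici.2 hs.1.le)
    (.of_forall fun s => (powerTest_pos a s).le),
    setIntegral_congr_fun measurableSet_Ioo fun s hs => powerTest_of_mem hs,
    integral_Ioo_rpow (by linarith) one_pos, Real.one_rpow, neg_add_eq_sub, one_div]

lemma lintegral_powerTest_le (ha : a < 1) :
    ∫⁻ s in Ioi 0, ENNReal.ofReal (powerTest a s) ≤ ENNReal.ofReal ((1 - a)⁻¹ + 1) := by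
  have tail_le : ∫⁻ s in Ici 1, ENNReal.ofReal (powerTest a s) ≤ ENNReal.ofReal 1 := calc
    ∫⁻ s in Ici 1, ENNReal.ofReal (powerTest a s)
        = ∫⁻ s in Ici (1 : ℝ), ENNReal.ofReal (Real.exp (-s)) :=
          setLIntegral_congr_fun measurableSet_Ici fun s hs => by rw [powerTest_of_one_le hs]
    _ ≤ ∫⁻ s in Ioi (0 : ℝ), ENNReal.ofReal (Real.exp (-s)) :=
          lintegral_mono_set (Ici_subset_Ioi.2 one_pos)
    _ = ENNReal.ofReal 1 := by
          rw [← ofReal_integral_eq_lintegral_ofReal (integrableOn_exp_neg_Ioi 0)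
            (.of_forall fun s => (Real.exp_pos _).le), integral_exp_neg_Ioi_zero]
  calc ∫⁻ s in Ioi 0, ENNReal.ofReal (powerTest a s)
      ≤ ∫⁻ s in Ioo 0 1 ∪ Ici 1, ENNReal.ofReal (powerTest a s) :=
        lintegral_mono_set fun s hs => (lt_or_ge s 1).imp (fun h => ⟨hs, h⟩) id
    _ ≤ (∫⁻ s in Ioo 0 1, ENNReal.ofReal (powerTest a s)) +
          ∫⁻ s in Ici 1, ENNReal.ofReal (powerTest a s) := lintegral_union_le _ _ _
    _ ≤ ENNReal.ofReal (1 - a)⁻¹ + ENNReal.ofReal 1 := by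
        rw [lintegral_Ioo_powerTest ha]
        gcongr
    _ = ENNReal.ofReal ((1 - a)⁻¹ + 1) :=
        (ENNReal.ofReal_add (inv_nonneg.2 (sub_pos.2 ha).le) zero_le_one).symm

lemma ofReal_div_le_of_mem_integralHardyBounds (hpq : p ≠ q) (ha : a < 1) (hpa : p * a < 1)
    (hqa : q * a < 1) (hH : H ∈ integralHardyBounds p q) :
    ENNReal.ofReal (((1 - q * a) / (1 - p * a)) ^ (1 / (p - q)) / (2 - a)) ≤ H := by
  set c := ((1 - q * a) / (1 - p * a)) ^ (1 / (p - q))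
  have hc : 0 ≤ c := Real.rpow_nonneg (div_nonneg (sub_pos.2 hqa).le (sub_pos.2 hpa).le) _
  have ha' : 0 < 1 - a := sub_pos.2 ha
  have hardy : ENNReal.ofReal (c * (1 - a)⁻¹) ≤ H * ENNReal.ofReal ((1 - a)⁻¹ + 1) := calc
    ENNReal.ofReal (c * (1 - a)⁻¹)
        = ∫⁻ t in Ioo 0 1, ENNReal.ofReal (integralGini p q (Ico 0 t) (powerTest a)) := by
          rw [ENNReal.ofReal_mul hc, ← lintegral_Ioo_powerTest ha,
            ← lintegral_const_mul' _ _ ENNReal.ofReal_ne_top]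
          exact setLIntegral_congr_fun measurableSet_Ioo fun t ht => by
            rw [integralGini_powerTest hpq hpa hqa ht, ENNReal.ofReal_mul hc]
    _ ≤ ∫⁻ t in Ioi 0, ENNReal.ofReal (integralGini p q (Ico 0 t) (powerTest a)) :=
          lintegral_mono_set Ioo_subset_Ioi_self
    _ ≤ H * ∫⁻ t in Ioi 0, ENNReal.ofReal (powerTest a t) :=
          hH _ (inL_powerTest ha) fun t ht => giniDom_powerTest hpq ha hpa hqa ht
    _ ≤ H * ENNReal.ofReal ((1 - a)⁻¹ + 1) := by
          gcongr
          exact lintegral_powerTest_le ha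
  have hsum : 0 < (1 - a)⁻¹ + 1 := by positivity
  have div_eq : c / (2 - a) = c * (1 - a)⁻¹ / ((1 - a)⁻¹ + 1) := by
    have : 2 - a ≠ 0 := by linarith
    field_simp
    ring
  rw [div_eq, ENNReal.ofReal_div_of_pos hsum]
  exact ENNReal.div_le_of_le_mul hardy

lemma ofReal_hardyConst_le_of_mem_integralHardyBounds_of_ne (hpq : p ≠ q) (hq : q ≤ 0)
    (hp0 : 0 ≤ p) (hp : p < 1) (hH : H ∈ integralHardyBounds p q) :
    ENNReal.ofReal (hardyConst p q) ≤ H := by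
  have hp' : 1 - p ≠ 0 := (sub_pos.2 hp).ne'
  have hratio : (1 - q) / (1 - p) ≠ 0 := (div_pos (by linarith) (sub_pos.2 hp)).ne'
  have hcont : ContinuousAt
      (fun a : ℝ => ((1 - q * a) / (1 - p * a)) ^ (1 / (p - q)) / (2 - a)) 1 := by
    refine .div (.rpow_const (.div (by fun_prop) (by fun_prop) ?_) (.inl ?_)) (by fun_prop) ?_
    · simpa using hp'
    · simpa using hratio
    · norm_num
  have hlim := ENNReal.tendsto_ofReal (hcont.tendsto.mono_left (nhdsWithin_le_nhds (s := Iio 1)))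
  rw [mul_one, mul_one, show (2 : ℝ) - 1 = 1 by norm_num, div_one, ← hardyConst_of_ne hpq] at hlim
  refine le_of_tendsto hlim ?_
  filter_upwards [Ioo_mem_nhdsLT zero_lt_one] with a ha
  exact ofReal_div_le_of_mem_integralHardyBounds hpq ha.2
    ((mul_le_of_le_one_right hp0 ha.2.le).trans_lt hp)
    ((mul_nonpos_of_nonpos_of_nonneg hq ha.1.le).trans_lt one_pos) hH

lemma ofReal_hardyConst_le_of_mem_integralHardyBounds (hq : q ≤ 0) (hp0 : 0 ≤ p) (hp : p < 1)
    (hH : H ∈ integralHardyBounds p q) : ENNReal.ofReal (hardyConst p q) ≤ H := by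
  rcases eq_or_ne p q with rfl | hpq
  · obtain rfl := le_antisymm hq hp0
    rw [hardyConst_self]
    refine le_of_tendsto (ENNReal.tendsto_ofReal tendsto_hardyConst_zero_neg_inv) ?_
    filter_upwards [eventually_ne_atTop 0] with n hn
    have hn' : -(n : ℝ)⁻¹ < 0 := neg_neg_of_pos (inv_pos.2 (Nat.cast_pos.2 (Nat.pos_of_ne_zero hn)))
    exact ofReal_hardyConst_le_of_mem_integralHardyBounds_of_ne hn'.ne' hn'.le le_rfl one_pos
      (integralHardyBounds_zero_zero_subset le_rfl hn'.le hH)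
  · exact ofReal_hardyConst_le_of_mem_integralHardyBounds_of_ne hpq hq hp0 hp hH

theorem isIntegralHardyConst_integralGini (hmin : min p q ≤ 0) (hmax0 : 0 ≤ max p q)
    (hmax : max p q < 1) :
    IsIntegralHardyConst (Ioi 0) (giniDom p q) (integralGini p q)
      (ENNReal.ofReal (hardyConst p q)) := by
  change IsLeast (integralHardyBounds p q) _
  wlog hqp : q ≤ p generalizing p q
  · rw [integralHardyBounds_comm, hardyConst_comm ((le_max_left p q).trans_lt hmax)
      ((le_max_right p q).trans_lt hmax)]
    exact this (min_comm p q ▸ hmin) (max_comm p q ▸ hmax0) (max_comm p q ▸ hmax) (le_of_not_ge hqp)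
  rw [min_eq_right hqp] at hmin
  rw [max_eq_left hqp] at hmax0 hmax
  exact ⟨ofReal_hardyConst_mem_integralHardyBounds hmin hmax0 hmax,
    fun H => ofReal_hardyConst_le_of_mem_integralHardyBounds hmin hmax0 hmax⟩

/-- Here `powerTest a` with `a` slightly below `1 / p` has arbitrarily large means relative to its
integral: `a` is chosen so that `1 - p * a = s⁻¹`. -/
lemma eq_top_of_mem_integralHardyBounds_of_one_le (hq : q ≤ 0) (hp : 1 ≤ p)
    (hH : H ∈ integralHardyBounds p q) : H = ⊤ := by
  have hp0 : 0 < p := one_pos.trans_le hp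
  have hsub : 0 < p - q := by linarith
  have hlim : Tendsto (fun s : ℝ => s ^ (1 / (p - q)) / 2) atTop atTop :=
    (tendsto_rpow_atTop (one_div_pos.2 hsub)).atTop_div_const two_pos
  refine top_le_iff.1 (le_of_tendsto (ENNReal.tendsto_ofReal_atTop.comp hlim) ?_)
  filter_upwards [eventually_ge_atTop 1] with s hs
  have hs0 : 0 < s := one_pos.trans_le hs
  have hs1 : s⁻¹ ≤ 1 := inv_le_one_of_one_le₀ hs
  obtain ⟨a, hpa⟩ : ∃ a, p * a = 1 - s⁻¹ := ⟨(1 - s⁻¹) / p, mul_div_cancel₀ _ hp0.ne'⟩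
  have ha0 : 0 ≤ a := nonneg_of_mul_nonneg_right (hpa ▸ sub_nonneg.2 hs1) hp0
  have hpa1 : p * a < 1 := hpa ▸ sub_lt_self 1 (inv_pos.2 hs0)
  have hqa : q * a ≤ 0 := mul_nonpos_of_nonpos_of_nonneg hq ha0
  have ha1 : a < 1 := (le_mul_of_one_le_left ha0 hp).trans_lt hpa1
  have ratio_ge : s ≤ (1 - q * a) / (1 - p * a) := by
    rw [hpa, sub_sub_cancel, div_inv_eq_mul]
    exact le_mul_of_one_le_left hs0.le (by linarith)
  refine le_trans (ENNReal.ofReal_le_ofReal ?_)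
    (ofReal_div_le_of_mem_integralHardyBounds (sub_pos.1 hsub).ne' ha1 hpa1
      (hqa.trans_lt one_pos) hH)
  exact div_le_div₀ (Real.rpow_nonneg (hs0.le.trans ratio_ge) _)
    (Real.rpow_le_rpow hs0.le ratio_ge (one_div_pos.2 hsub).le) (by linarith) (by linarith)

lemma eq_top_of_mem_integralHardyBounds_of_tendsto (hH : H ∈ integralHardyBounds p q)
    (hf : InL (Ioi 0) (Ici 0) f) (hdom : ∀ t : ℝ, 0 < t → giniDom p q (Ico 0 t) f) {m : ℝ}
    (hm : 0 < m) (hlim : Tendsto (fun t => integralGini p q (Ico 0 t) f) atTop (𝓝 m)) : H = ⊤ := by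
  by_contra hHtop
  have means_ne_top := ne_top_of_le_ne_top (ENNReal.mul_ne_top hHtop (lintegral_ofReal_ne_top hf))
    (hH f hf hdom)
  obtain ⟨T, hT⟩ := eventually_atTop.1 ((hlim.eventually_const_lt (half_lt_self hm)).and
    (eventually_gt_atTop (0 : ℝ)))
  refine means_ne_top (top_le_iff.1 ?_)
  calc ⊤ = ∫⁻ _ in Ici T, ENNReal.ofReal (m / 2) := by
        rw [setLIntegral_const, Real.volume_Ici, ENNReal.mul_top]
        exact (ENNReal.ofReal_pos.2 (half_pos hm)).ne'
    _ ≤ ∫⁻ t in Ici T, ENNReal.ofReal (integralGini p q (Ico 0 t) f) :=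
        setLIntegral_mono' measurableSet_Ici fun t ht =>
          ENNReal.ofReal_le_ofReal (hT t ht).1.le
    _ ≤ ∫⁻ t in Ioi 0, ENNReal.ofReal (integralGini p q (Ico 0 t) f) :=
        lintegral_mono_set fun t ht => (hT t ht).2

lemma tendsto_integral_Ico (hf : IntegrableOn f (Ioi 0)) :
    Tendsto (fun t => ∫ s in Ico 0 t, f s) atTop (𝓝 (∫ s in Ioi 0, f s)) := by
  refine (intervalIntegral_tendsto_integral_Ioi 0 hf tendsto_id).congr' ?_
  filter_upwards [eventually_ge_atTop (0 : ℝ)] with t ht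
  rw [id, intervalIntegral.integral_of_le ht, integral_Ico_eq_integral_Ioo,
    integral_Ioc_eq_integral_Ioo]

lemma giniIntegrable_exp_neg (hp : 0 < p) (hq : 0 < q) :
    GiniIntegrable p q (volume.restrict (Ioi 0)) fun s => Real.exp (-s) := by
  have rpow_int {r : ℝ} (hr : 0 < r) : IntegrableOn (fun s => Real.exp (-s) ^ r) (Ioi 0) := by
    simpa only [exp_neg_rpow] using exp_neg_integrableOn_Ioi 0 hr
  refine ⟨by simp, .of_forall fun s => Real.exp_pos _, rpow_int hp, rpow_int hq, fun _ => ?_⟩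
  have := (integrableOn_rpow_mul_exp_neg_mul_rpow (s := 1) (by norm_num) one_pos hp).neg
  refine this.congr (.of_forall fun s => ?_)
  simp only [Pi.neg_apply, Real.rpow_one, exp_neg_rpow, Real.log_exp]
  ring

lemma eq_top_of_mem_integralHardyBounds_of_pos (hp : 0 < p) (hq : 0 < q)
    (hH : H ∈ integralHardyBounds p q) : H = ⊤ := by
  have h := giniIntegrable_exp_neg hp hq
  have integrableOn_Ici {g : ℝ → ℝ} (hg : IntegrableOn g (Ioi 0)) : IntegrableOn g (Ici 0) :=
    (integrableOn_Ici_iff_integrableOn_Ioi (by simp)).2 hg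
  have hf : InL (Ioi 0) (Ici 0) fun s => Real.exp (-s) :=
    ⟨integrableOn_Ici (integrableOn_exp_neg_Ioi 0), fun s _ => Real.exp_pos _⟩
  have hdom (t : ℝ) (ht : 0 < t) : giniDom p q (Ico 0 t) fun s => Real.exp (-s) :=
    ⟨isBddInterval_Ico ht, ⟨hf.1.mono_set Ico_subset_Ici_self, fun s _ => Real.exp_pos _⟩,
      (integrableOn_Ici h.left).mono_set Ico_subset_Ici_self,
      fun _ => (integrableOn_Ici h.right).mono_set Ico_subset_Ici_self,
      fun hpq => (integrableOn_Ici (h.log hpq)).mono_set Ico_subset_Ici_self⟩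
  exact eq_top_of_mem_integralHardyBounds_of_tendsto hH hf hdom h.giniMean_pos <|
    tendsto_giniMean h (tendsto_integral_Ico h.left) (fun _ => tendsto_integral_Ico h.right)
      fun hpq => tendsto_integral_Ico (h.log hpq)

theorem isIntegralHardyConst_integralGini_top (h : 0 < min p q ∨ 1 ≤ max p q) :
    IsIntegralHardyConst (Ioi 0) (giniDom p q) (integralGini p q) ⊤ := by
  refine ⟨top_mem_integralHardyBounds p q,
    fun H (hH : H ∈ integralHardyBounds p q) => top_le_iff.2 ?_⟩
  wlog hqp : q ≤ p generalizing p q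
  · exact this (by rwa [min_comm, max_comm]) (integralHardyBounds_comm p q ▸ hH) (le_of_not_ge hqp)
  rw [min_eq_right hqp, max_eq_left hqp] at h
  rcases lt_or_ge 0 q with hq | hq
  · exact eq_top_of_mem_integralHardyBounds_of_pos (hq.trans_le hqp) hq hH
  · exact eq_top_of_mem_integralHardyBounds_of_one_le hq (h.resolve_left hq.not_gt) hH

end IntegralLower

end GiniHardy

theorem mainTheorem4 :
    -- the explicit integral Gini means are integral means on `(0, ∞)`, and they are given by the
    -- weighted Gini means on simple functions
    (∀ p q : ℝ,
      GiniHardy.IsIntegralMean (Ioi 0) (GiniHardy.giniDom p q) (GiniHardy.integralGini p q) ∧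
      ∀ (J : Set ℝ) (g : ℝ → ℝ) (n : ℕ) (c : Fin (n + 1) → ℝ) (v : Fin n → ℝ),
        GiniHardy.IsBddInterval J → MapsTo g J (Ioi 0) → GiniHardy.IsSimpleOn J g n c v →
        GiniHardy.giniDom p q J g ∧
        GiniHardy.integralGini p q J g = GiniHardy.gini p q n v (GiniHardy.lengths c)) ∧
    -- existence, uniqueness and form of the extension
    (∀ (p q : ℝ) (N : Set ℝ → (ℝ → ℝ) → ℝ),
      GiniHardy.IsContinuousExtension p q N ↔
        ∀ J f, GiniHardy.giniDom p q J f → N J f = GiniHardy.integralGini p q J f) ∧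
    -- the discrete and the integral Hardy constants are equal, and their values
    (∀ p q : ℝ, p ≠ q → min p q ≤ 0 → 0 ≤ max p q → max p q < 1 →
      GiniHardy.IsHardyConst (Ioi 0) (GiniHardy.gini p q)
        (ENNReal.ofReal (((1 - q) / (1 - p)) ^ (1 / (p - q)))) ∧
      GiniHardy.IsIntegralHardyConst (Ioi 0) (GiniHardy.giniDom p q) (GiniHardy.integralGini p q)
        (ENNReal.ofReal (((1 - q) / (1 - p)) ^ (1 / (p - q))))) ∧
    (GiniHardy.IsHardyConst (Ioi 0) (GiniHardy.gini 0 0) (ENNReal.ofReal (Real.exp 1)) ∧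
      GiniHardy.IsIntegralHardyConst (Ioi 0) (GiniHardy.giniDom 0 0) (GiniHardy.integralGini 0 0)
        (ENNReal.ofReal (Real.exp 1))) ∧
    (∀ p q : ℝ, 0 < min p q ∨ 1 ≤ max p q →
      GiniHardy.IsHardyConst (Ioi 0) (GiniHardy.gini p q) ⊤ ∧
      GiniHardy.IsIntegralHardyConst (Ioi 0) (GiniHardy.giniDom p q) (GiniHardy.integralGini p q)
        ⊤) ∧
    -- the bound in the remaining range; in particular these integral means are Hardy
    (∀ p q : ℝ, max p q ≤ 0 →
      ∃ C : ENNReal, C ≤ ENNReal.ofReal (Real.exp 1) ∧ C < ⊤ ∧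
        GiniHardy.IsIntegralHardyConst (Ioi 0) (GiniHardy.giniDom p q)
          (GiniHardy.integralGini p q) C) := by
  refine ⟨fun p q => ⟨GiniHardy.isIntegralMean_integralGini p q, fun J g n c v hJ hg h =>
      ⟨h.giniDom p q hJ hg, h.integralGini_eq p q hJ⟩⟩,
    GiniHardy.isContinuousExtension_iff, fun p q hpq hmin hmax0 hmax => ?_, ?_,
    fun p q h => ⟨GiniHardy.isHardyConst_gini_top h,
      GiniHardy.isIntegralHardyConst_integralGini_top h⟩,
    fun p q h => GiniHardy.exists_isIntegralHardyConst_le_exp_one h⟩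
  · rw [← GiniHardy.hardyConst_of_ne hpq]
    exact ⟨GiniHardy.isHardyConst_gini hmin hmax0 hmax,
      GiniHardy.isIntegralHardyConst_integralGini hmin hmax0 hmax⟩
  · rw [← GiniHardy.hardyConst_self 0]
    exact ⟨GiniHardy.isHardyConst_gini (by simp) (by simp) (by simp),
      GiniHardy.isIntegralHardyConst_integralGini (by simp) (by simp) (by simp)⟩
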